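/- **Setting.** Let $(W,S)$ be a Coxeter group with $S$ finite; for $J\subseteq S$ let $W_J=\langle J\rangle$. Graphs are graphs in the sense of Serre, with oriented edges, origin $o$, terminus $t$ and edge inversion $e\mapsto\bar e$. A *graph of special subgroups* $(\mathcal G,\Lambda)$ of $(W,S)$ over a connected graph $\Lambda$ is given by subsets $S_\lambda\subseteq S$, one for each vertex and edge $\lambda$ of $\Lambda$, with $S_{\bar e}=S_e\subseteq S_{t(e)}$; its groups are $\mathcal G_\lambda=W_{S_\lambda}$ and its monomorphisms $\mathcal G_e\to\mathcal G_{t(e)}$ are the inclusions. It is a *visual graph of groups decomposition* of $(W,S)$ if the homomorphism $\pi_1(\mathcal G,\Lambda)\to W$ induced by the inclusions of the vertex groups (and trivial on the edges of $\Lambda$) is an isomorphism. Here $\pi_1(\mathcal G,\Lambda)$ is the fundamental group of the graph of groups, taken with respect to a maximal subtree of $\Lambda$. Let $\Delta=(\mathcal C,\delta)$ be a building of type $(W,S)$. For $J\subseteq S$ and $c\in\mathcal C$ put $\mathrm{Res}_J(c)=\{d\in\mathcal C\mid\delta(c,d)\in W_J\}$. The *residue graph* $\Gamma=\Gamma^\Delta_{(\mathcal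 G,\Lambda)}(\mathcal C)$ has vertex set $\bigsqcup_{v}\{\mathrm{Res}_{S_v}(c)\mid c\in\mathcal C\}$, $v$ ranging over the vertices of $\Lambda$, and edge set $\bigsqcup_{e}\{\mathrm{Res}_{S_e}(c)\mid c\in\mathcal C\}$, $e$ ranging over the edges of $\Lambda$, with $$o(\mathrm{Res}_{S_e}(c))=\mathrm{Res}_{S_{o(e)}}(c),\qquad t(\mathrm{Res}_{S_e}(c))=\mathrm{Res}_{S_{t(e)}}(c),\qquad \overline{\mathrm{Res}_{S_e}(c)}=\mathrm{Res}_{S_{\bar e}}(c).$$ A topological group $G$ *acts on* $\Delta$ if it is given a continuous homomorphism from $G$ to the group of bijections of $\mathcal C$ preserving $\delta$, endowed with the permutation topology (the pointwise stabilisers of finite sets of chambers form a neighbourhood basis of the identity). **Corollary G.** Let $G$ be a $\sigma$-compact totally disconnected locally compact (t.d.l.c.) group acting on a building $\Delta=(\mathcal C,\delta)$ of type $(W,S)$ transitively on the set $\mathcal C$ of chambers, let $c\in\mathcal C$, and let $(\mathcal G,\Lambda)$ be a visual graph of groups decomposition of $(W,S)$. For each vertex or edge $\lambda$ of $\Lambda$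 let $\widetilde{\mathcal G}_\lambda$ be the setwise stabiliser of $\mathrm{Res}_{S_\lambda}(c)$ in $G$. Then: 1. $\Lambda$ is a tree, and the groups $\widetilde{\mathcal G}_\lambda$ with the inclusions $\widetilde{\mathcal G}_e\hookrightarrow\widetilde{\mathcal G}_{t(e)}$ form a tree of t.d.l.c. groups $(\widetilde{\mathcal G},\Lambda)$, i.e. all $\widetilde{\mathcal G}_\lambda$ are t.d.l.c. and the inclusions are continuous and open. 2. The topology on $\pi_1(\widetilde{\mathcal G},\Lambda)$ generated by the left cosets of the open subgroups of the vertex groups makes it a topological group in which these open subgroups form a neighbourhood basis of the identity. The homomorphism $\varphi\colon\pi_1(\widetilde{\mathcal G},\Lambda)\to G$ induced by the inclusions $\widetilde{\mathcal G}_v\hookrightarrow G$ is an isomorphism of topological groups. 3. The universal Bass–Serre graph of $(\widetilde{\mathcal G},\Lambda)$, whose vertices and edges are the left cosets in $\pi_1(\widetilde{\mathcal G},\Lambda)$ of the vertex and edge groups, is a tree, and it is isomorphic to the residue graph $\Gamma$ through $g\,\widetilde{\mathcal G}_\lambda\mapsto\mathrm{Res}_{S_\lambda}(\varphi(g)\cdot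 c)$. -/

import Mathlib

open scoped Topology

universe u v w

/-! ### Graphs in the sense of Serre -/

/-- A graph in the sense of Serre: vertices, oriented edges, origin, terminus and a fixed-point
free edge inversion. -/
structure SerreGraph where
  V : Type u
  E : Type v
  o : E → V
  t : E → V
  inv : E → E
  inv_inv : ∀ e, inv (inv e) = e
  inv_ne : ∀ e, inv e ≠ e
  o_inv : ∀ e, o (inv e) = t e

namespace SerreGraph

variable (X : SerreGraph.{u, v})

theorem t_inv (e : X.E) : X.t (X.inv e) = X.o e := by
  rw [← X.o_inv, X.inv_inv]

/-- `X.IsPath a p b`: the list of edges `p` is a path from `a` to `b`. -/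
def IsPath : X.V → List X.E → X.V → Prop
  | a, [], b => a = b
  | a, e :: p, b => X.o e = a ∧ IsPath (X.t e) p b

/-- A path without backtracking. -/
def IsReduced (p : List X.E) : Prop :=
  p.IsChain fun e f => f ≠ X.inv e

/-- Connected (and non-empty). -/
def IsConnected : Prop :=
  Nonempty X.V ∧ ∀ a b, ∃ p, X.IsPath a p b

/-- A tree: a connected non-empty graph with no closed path without backtracking of positive
length. -/
def IsTree : Prop :=
  X.IsConnected ∧ ∀ a p, X.IsPath a p a → X.IsReduced p → p = []

/-- The subgraph with all the vertices and with edge set `T`. -/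
def spanningSubgraph (T : Set X.E) (hT : ∀ e ∈ T, X.inv e ∈ T) : SerreGraph.{u, v} where
  V := X.V
  E := T
  o e := X.o e
  t e := X.t e
  inv e := ⟨X.inv e, hT e e.2⟩
  inv_inv e := Subtype.ext (X.inv_inv e)
  inv_ne e h := X.inv_ne e (congrArg Subtype.val h)
  o_inv e := X.o_inv e

/-- `T` is the edge set of a maximal subtree (in a connected graph, a maximal subtree is the same
as a subtree containing all the vertices). -/
def IsMaximalTree (T : Set X.E) : Prop :=
  ∃ hT : ∀ e ∈ T, X.inv e ∈ T, (X.spanningSubgraph T hT).IsTree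

/-- Isomorphisms of graphs. -/
structure Iso (X : SerreGraph) (Y : SerreGraph) where
  onV : X.V ≃ Y.V
  onE : X.E ≃ Y.E
  map_o : ∀ e, onV (X.o e) = Y.o (onE e)
  map_t : ∀ e, onV (X.t e) = Y.t (onE e)
  map_inv : ∀ e, onE (X.inv e) = Y.inv (onE e)

end SerreGraph

/-! ### Graphs of groups

All graphs of groups below consist of subgroups of one ambient group, and the monomorphisms
from the edge groups to the vertex groups are inclusions. -/

/-- A graph of groups based on `Λ` whose vertex and edge groups are subgroups of `H` and whose
monomorphisms `edge e → vert (t e)` are the inclusions. -/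
structure GraphOfSubgroups (Λ : SerreGraph.{u, v}) (H : Type w) [Group H] where
  vert : Λ.V → Subgroup H
  edge : Λ.E → Subgroup H
  edge_inv : ∀ e, edge (Λ.inv e) = edge e
  edge_le : ∀ e, edge e ≤ vert (Λ.t e)

namespace GraphOfSubgroups

variable {Λ : SerreGraph.{u, v}} {H : Type w} [Group H] (𝒢 : GraphOfSubgroups Λ H)

theorem edge_le_o (e : Λ.E) : 𝒢.edge e ≤ 𝒢.vert (Λ.o e) := by
  have h := 𝒢.edge_le (Λ.inv e)
  rwa [𝒢.edge_inv, Λ.t_inv] at h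

/-- The free product of all the vertex groups and of the free group on the edges. -/
abbrev PreGroup : Type _ :=
  Monoid.Coprod (Monoid.CoprodI fun x => 𝒢.vert x) (FreeGroup Λ.E)

/-- A vertex group in the free product. -/
def preVert (x : Λ.V) : 𝒢.vert x →* 𝒢.PreGroup :=
  Monoid.Coprod.inl.comp (Monoid.CoprodI.of (M := fun x => 𝒢.vert x) (i := x))

/-- An edge as an element of the free product. -/
def preEdge (e : Λ.E) : 𝒢.PreGroup :=
  Monoid.Coprod.inr (FreeGroup.of e)

/-- The relators of the fundamental group with respect to a maximal tree `T`:
`e * ē = 1`, `e * a * e⁻¹ = a` for `a` in the edge group of `e`, where the `a` on the left is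
taken in the vertex group of `t e` and that on the right in the vertex group of `o e`, and `e = 1`
for `e ∈ T`. -/
inductive Relator (T : Set Λ.E) : 𝒢.PreGroup → Prop
  | inv (e : Λ.E) : Relator T (𝒢.preEdge e * 𝒢.preEdge (Λ.inv e))
  | conj (e : Λ.E) (a : 𝒢.edge e) :
      Relator T (𝒢.preEdge e * 𝒢.preVert (Λ.t e) (Subgroup.inclusion (𝒢.edge_le e) a) *
        (𝒢.preEdge e)⁻¹ * (𝒢.preVert (Λ.o e) (Subgroup.inclusion (𝒢.edge_le_o e) a))⁻¹)
  | tree (e : Λ.E) (he : e ∈ T) : Relator T (𝒢.preEdge e)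

/-- The fundamental group `π₁(𝒢, Λ, T)` of a graph of groups with respect to a maximal
tree `T`. -/
def Pi1 (T : Set Λ.E) : Type _ :=
  𝒢.PreGroup ⧸ Subgroup.normalClosure {r | 𝒢.Relator T r}

variable (T : Set Λ.E)

instance : Group (𝒢.Pi1 T) :=
  inferInstanceAs (Group (𝒢.PreGroup ⧸ Subgroup.normalClosure {r | 𝒢.Relator T r}))

/-- The quotient map onto the fundamental group. -/
def toPi1 : 𝒢.PreGroup →* 𝒢.Pi1 T :=
  QuotientGroup.mk' (Subgroup.normalClosure {r | 𝒢.Relator T r})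

/-- The canonical map from a vertex group to the fundamental group. -/
def ofVert (x : Λ.V) : 𝒢.vert x →* 𝒢.Pi1 T :=
  (𝒢.toPi1 T).comp (𝒢.preVert x)

/-- The element of the fundamental group given by an edge. -/
def ofEdge (e : Λ.E) : 𝒢.Pi1 T :=
  𝒢.toPi1 T (𝒢.preEdge e)

theorem toPi1_relator {r : 𝒢.PreGroup} (h : 𝒢.Relator T r) : 𝒢.toPi1 T r = 1 :=
  (QuotientGroup.eq_one_iff r).2 (Subgroup.subset_normalClosure h)

theorem ofEdge_inv (e : Λ.E) : 𝒢.ofEdge T (Λ.inv e) = (𝒢.ofEdge T e)⁻¹ := by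
  have h := 𝒢.toPi1_relator T (.inv e)
  rw [map_mul] at h
  exact eq_inv_of_mul_eq_one_right h

theorem ofEdge_conj (e : Λ.E) (a : 𝒢.edge e) :
    𝒢.ofEdge T e * 𝒢.ofVert T (Λ.t e) (Subgroup.inclusion (𝒢.edge_le e) a) *
      (𝒢.ofEdge T e)⁻¹ = 𝒢.ofVert T (Λ.o e) (Subgroup.inclusion (𝒢.edge_le_o e) a) := by
  have h := 𝒢.toPi1_relator T (.conj e a)
  rw [map_mul, map_mul, map_mul, map_inv, map_inv] at h
  exact mul_inv_eq_one.1 h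

/-- The homomorphism from the free product to the ambient group that is the inclusion on every
vertex group and sends every edge to `1`. -/
def preToAmbient : 𝒢.PreGroup →* H :=
  Monoid.Coprod.lift (Monoid.CoprodI.lift fun x => (𝒢.vert x).subtype) 1

theorem preToAmbient_relator {r : 𝒢.PreGroup} (h : 𝒢.Relator T r) :
    𝒢.preToAmbient r = 1 := by
  cases h <;> simp [preToAmbient, preEdge, preVert]

/-- The homomorphism from the fundamental group to the ambient group induced by the inclusions
of the vertex groups (and sending every edge to `1`). -/
def toAmbient : 𝒢.Pi1 T →* H :=
  QuotientGroup.lift (Subgroup.normalClosure {r | 𝒢.Relator T r}) 𝒢.preToAmbient fun _ h =>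
    (Subgroup.normalClosure_le_normal (N := 𝒢.preToAmbient.ker)
      fun _ hr => 𝒢.preToAmbient_relator T hr) h

/-! #### The universal Bass–Serre graph -/

/-- The image of a vertex group in the fundamental group. -/
def vertImage (x : Λ.V) : Subgroup (𝒢.Pi1 T) :=
  (𝒢.ofVert T x).range

/-- The image of the edge group of `e` in the fundamental group, through the vertex group of
the terminus of `e`. -/
def edgeImage (e : Λ.E) : Subgroup (𝒢.Pi1 T) :=
  ((𝒢.ofVert T (Λ.t e)).comp (Subgroup.inclusion (𝒢.edge_le e))).range

theorem edgeImage_le (e : Λ.E) : 𝒢.edgeImage T e ≤ 𝒢.vertImage T (Λ.t e) := by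
  rintro _ ⟨a, rfl⟩
  exact ⟨_, rfl⟩

theorem ofVert_congr {x y : Λ.V} (h : x = y) (a : H) (hx : a ∈ 𝒢.vert x) (hy : a ∈ 𝒢.vert y) :
    𝒢.ofVert T x ⟨a, hx⟩ = 𝒢.ofVert T y ⟨a, hy⟩ := by
  subst h; rfl

theorem conj_mem_edgeImage (e : Λ.E) {h : 𝒢.Pi1 T} (hh : h ∈ 𝒢.edgeImage T e) :
    𝒢.ofEdge T e * h * (𝒢.ofEdge T e)⁻¹ ∈ 𝒢.edgeImage T (Λ.inv e) := by
  obtain ⟨a, rfl⟩ := hh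
  refine ⟨⟨a, by rw [𝒢.edge_inv]; exact a.2⟩, ?_⟩
  exact (𝒢.ofVert_congr T (Λ.t_inv e) _ _ _).trans (𝒢.ofEdge_conj T e a).symm

theorem conj_mem_vertImage (e : Λ.E) {h : 𝒢.Pi1 T} (hh : h ∈ 𝒢.edgeImage T e) :
    𝒢.ofEdge T e * h * (𝒢.ofEdge T e)⁻¹ ∈ 𝒢.vertImage T (Λ.o e) := by
  obtain ⟨a, rfl⟩ := hh
  exact ⟨_, (𝒢.ofEdge_conj T e a).symm⟩

/-- The map `g ↦ g * e⁻¹` on cosets. -/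
def cosetShift (e : Λ.E) (K : Subgroup (𝒢.Pi1 T))
    (hK : ∀ h ∈ 𝒢.edgeImage T e, 𝒢.ofEdge T e * h * (𝒢.ofEdge T e)⁻¹ ∈ K) :
    𝒢.Pi1 T ⧸ 𝒢.edgeImage T e → 𝒢.Pi1 T ⧸ K :=
  Quotient.map' (fun g => g * (𝒢.ofEdge T e)⁻¹) fun g g' h => by
    rw [QuotientGroup.leftRel_apply] at h ⊢
    simpa [mul_assoc] using hK _ h

theorem sigma_mk_eq {ι : Type*} (K : ι → Subgroup (𝒢.Pi1 T)) {i j : ι} (hij : i = j)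
    {g g' : 𝒢.Pi1 T} (hg : g = g') :
    (⟨i, (g : 𝒢.Pi1 T ⧸ K i)⟩ : Σ i, 𝒢.Pi1 T ⧸ K i) = ⟨j, (g' : 𝒢.Pi1 T ⧸ K j)⟩ := by
  subst hij hg; rfl

/-- The universal Bass–Serre graph of a graph of groups: its vertices are the cosets `g 𝒢_x`,
its edges are the cosets `g 𝒢_e`, where `𝒢_e` is viewed in `𝒢_{t(e)}`; the terminus of `g 𝒢_e`
is `g 𝒢_{t(e)}`, its origin is `g e⁻¹ 𝒢_{o(e)}`, its inverse is `g e⁻¹ 𝒢_ē`. -/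
def bassSerreGraph : SerreGraph where
  V := Σ x : Λ.V, 𝒢.Pi1 T ⧸ 𝒢.vertImage T x
  E := Σ e : Λ.E, 𝒢.Pi1 T ⧸ 𝒢.edgeImage T e
  o p := ⟨Λ.o p.1, 𝒢.cosetShift T p.1 _ (fun _ => 𝒢.conj_mem_vertImage T p.1) p.2⟩
  t p := ⟨Λ.t p.1, Subgroup.quotientMapOfLE (𝒢.edgeImage_le T p.1) p.2⟩
  inv p := ⟨Λ.inv p.1, 𝒢.cosetShift T p.1 _ (fun _ => 𝒢.conj_mem_edgeImage T p.1) p.2⟩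
  inv_inv := by
    rintro ⟨e, q⟩
    induction q using QuotientGroup.induction_on with
    | H g => exact 𝒢.sigma_mk_eq T _ (Λ.inv_inv e) (by simp [ofEdge_inv])
  inv_ne p h := Λ.inv_ne p.1 (congrArg Sigma.fst h)
  o_inv := by
    rintro ⟨e, q⟩
    induction q using QuotientGroup.induction_on with
    | H g => exact 𝒢.sigma_mk_eq T _ (Λ.o_inv e) (by simp [ofEdge_inv])

/-! #### Topology -/

/-- All vertex and edge groups are totally disconnected and locally compact, and the inclusions
of edge groups into vertex groups are continuous and open. -/
def IsTDLC [TopologicalSpace H] : Prop :=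
  (∀ x, TotallyDisconnectedSpace (𝒢.vert x) ∧ LocallyCompactSpace (𝒢.vert x)) ∧
  (∀ e, TotallyDisconnectedSpace (𝒢.edge e) ∧ LocallyCompactSpace (𝒢.edge e)) ∧
  ∀ e, Continuous (Subgroup.inclusion (𝒢.edge_le e)) ∧
    IsOpenMap (Subgroup.inclusion (𝒢.edge_le e))

/-- The topology on the fundamental group generated by the left cosets of the open subgroups
of the vertex groups. -/
instance [TopologicalSpace H] : TopologicalSpace (𝒢.Pi1 T) :=
  .generateFrom {A | ∃ (g : 𝒢.Pi1 T) (x : Λ.V) (U : OpenSubgroup (𝒢.vert x)),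
    A = (fun a => g * 𝒢.ofVert T x a) '' U}

end GraphOfSubgroups

/-! ### Coxeter groups and visual decompositions -/

namespace CoxeterSystem

variable {B : Type*} {M : CoxeterMatrix B} {W : Type*} [Group W] (cs : CoxeterSystem M W)

/-- The special subgroup `W_J`. -/
def special (J : Set B) : Subgroup W :=
  Subgroup.closure (cs.simple '' J)

theorem special_mono {J K : Set B} (h : J ⊆ K) : cs.special J ≤ cs.special K :=
  Subgroup.closure_mono (Set.image_mono h)

end CoxeterSystem

/-- The subsets `S_λ` of the generating set defining a graph of special subgroups based
on `Λ`. -/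
structure SpecialData (Λ : SerreGraph.{u, v}) (B : Type w) where
  vert : Λ.V → Set B
  edge : Λ.E → Set B
  edge_inv : ∀ e, edge (Λ.inv e) = edge e
  edge_subset : ∀ e, edge e ⊆ vert (Λ.t e)

namespace SpecialData

variable {Λ : SerreGraph.{u, v}} {B : Type w} (D : SpecialData Λ B)

theorem edge_subset_o (e : Λ.E) : D.edge e ⊆ D.vert (Λ.o e) := by
  have h := D.edge_subset (Λ.inv e)
  rwa [D.edge_inv, Λ.t_inv] at h

variable {M : CoxeterMatrix B} {W : Type*} [Group W] (cs : CoxeterSystem M W)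

/-- The graph of special subgroups `W_{S_λ}`. -/
def graphOfSpecial : GraphOfSubgroups Λ W where
  vert x := cs.special (D.vert x)
  edge e := cs.special (D.edge e)
  edge_inv e := by rw [D.edge_inv]
  edge_le e := cs.special_mono (D.edge_subset e)

/-- A visual graph of groups decomposition of `(W, S)`: `Λ` is connected and the homomorphism
from the fundamental group to `W` induced by the inclusions is an isomorphism. -/
def IsVisualDecomposition : Prop :=
  Λ.IsConnected ∧ ∃ T : Set Λ.E, Λ.IsMaximalTree T ∧
    Function.Bijective ((D.graphOfSpecial cs).toAmbient T)

end SpecialData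

/-! ### Buildings -/

/-- A building of type `(W, S)` with set of chambers `C`, as a `W`-metric space. -/
structure Building {B : Type*} {M : CoxeterMatrix B} {W : Type*} [Group W]
    (cs : CoxeterSystem M W) (C : Type*) where
  δ : C → C → W
  nonempty : Nonempty C
  δ_eq_one : ∀ c d, δ c d = 1 ↔ c = d
  δ_adj : ∀ c d c' s, δ c' c = cs.simple s →
    δ c' d = cs.simple s * δ c d ∨ δ c' d = δ c d
  δ_adj_of_length : ∀ c d c' s, δ c' c = cs.simple s →
    cs.length (cs.simple s * δ c d) = cs.length (δ c d) + 1 → δ c' d = cs.simple s * δ c d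
  exists_adj : ∀ c d s, ∃ c', δ c' c = cs.simple s ∧ δ c' d = cs.simple s * δ c d

namespace Building

variable {B : Type*} {M : CoxeterMatrix B} {W : Type*} [Group W] {cs : CoxeterSystem M W}
  {C : Type*} (Δ : Building cs C)

/-- The `J`-residue centred at `c`. -/
def res (J : Set B) (c : C) : Set C :=
  {d | Δ.δ c d ∈ cs.special J}

theorem mem_res_self (J : Set B) (c : C) : c ∈ Δ.res J c := by
  change Δ.δ c c ∈ cs.special J
  rw [(Δ.δ_eq_one c c).2 rfl]
  exact one_mem _

theorem δ_mem_iff_of_adj {J : Set B} {s : B} (hs : s ∈ J) {c c' : C}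
    (h : Δ.δ c' c = cs.simple s) (x : C) :
    Δ.δ c' x ∈ cs.special J ↔ Δ.δ c x ∈ cs.special J := by
  have hs' : cs.simple s ∈ cs.special J := Subgroup.subset_closure ⟨s, hs, rfl⟩
  rcases Δ.δ_adj c x c' s h with h | h <;> rw [h]
  exact Subgroup.mul_mem_cancel_left _ hs'

theorem res_eq_of_mem {J : Set B} {c d : C} (h : d ∈ Δ.res J c) : Δ.res J c = Δ.res J d := by
  have key : ∀ w ∈ cs.special J, ∀ c, Δ.δ c d = w⁻¹ → Δ.res J c = Δ.res J d := by
    intro w hw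
    induction hw using Subgroup.closure_induction_right with
    | one =>
      intro c hc
      rw [(Δ.δ_eq_one c d).1 (by simpa using hc)]
    | mul_right w _ y hy ih =>
      intro c hc
      obtain ⟨s, hs, rfl⟩ := hy
      obtain ⟨c', h1, h2⟩ := Δ.exists_adj c d s
      rw [← ih c' (by rw [h2, hc]; simp)]
      exact Set.ext fun x => (Δ.δ_mem_iff_of_adj hs h1 x).symm
    | mul_inv_cancel w _ y hy ih =>
      intro c hc
      obtain ⟨s, hs, rfl⟩ := hy
      obtain ⟨c', h1, h2⟩ := Δ.exists_adj c d s
      rw [← ih c' (by rw [h2, hc]; simp)]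
      exact Set.ext fun x => (Δ.δ_mem_iff_of_adj hs h1 x).symm
  exact key (Δ.δ c d)⁻¹ (inv_mem h) c (by simp)

/-- The set of all `J`-residues. -/
def residues (J : Set B) : Set (Set C) :=
  Set.range (Δ.res J)

/-- The map from `J`-residues to `K`-residues, for `J ⊆ K`, that sends the `J`-residue of `c`
to the `K`-residue of `c`. -/
def resMap {J K : Set B} (h : J ⊆ K) (R : Δ.residues J) : Δ.residues K :=
  ⟨⋃ c ∈ R.1, Δ.res K c, by
    obtain ⟨_, c, rfl⟩ := R
    refine ⟨c, subset_antisymm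
      (Set.subset_iUnion₂ (s := fun c _ => Δ.res K c) c (Δ.mem_res_self J c))
      (Set.iUnion₂_subset fun d hd => ?_)⟩
    rw [Δ.res_eq_of_mem (cs.special_mono h hd : d ∈ Δ.res K c)]⟩

theorem resMap_res {J K : Set B} (h : J ⊆ K) (c : C) :
    (Δ.resMap h ⟨Δ.res J c, Set.mem_range_self c⟩).1 = Δ.res K c := by
  refine subset_antisymm (Set.iUnion₂_subset fun d hd => ?_)
    (Set.subset_iUnion₂ (s := fun c _ => Δ.res K c) c (Δ.mem_res_self J c))
  rw [Δ.res_eq_of_mem (cs.special_mono h hd : d ∈ Δ.res K c)]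

theorem sigma_residue_eq {ι : Type*} (S : ι → Set B) {i j : ι} (hij : i = j)
    {R : Δ.residues (S i)} {R' : Δ.residues (S j)} (hR : R.1 = R'.1) :
    (⟨i, R⟩ : Σ i, Δ.residues (S i)) = ⟨j, R'⟩ := by
  subst hij
  rw [Subtype.ext hR]

theorem residues_inv {Λ : SerreGraph.{u, v}} (D : SpecialData Λ B) (e : Λ.E) {R : Set C}
    (hR : R ∈ Δ.residues (D.edge e)) : R ∈ Δ.residues (D.edge (Λ.inv e)) := by
  rwa [D.edge_inv]

theorem resMap_val_congr {J J' K K' : Set B} (h : J ⊆ K) (h' : J' ⊆ K') (hK : K = K')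
    (R : Δ.residues J) (R' : Δ.residues J') (hR : R.1 = R'.1) :
    (Δ.resMap h R).1 = (Δ.resMap h' R').1 := by
  subst hK
  simp only [resMap, hR]

/-- The residue graph of a building with respect to a graph of special subgroups. -/
def residueGraph {Λ : SerreGraph.{u, v}} (D : SpecialData Λ B) : SerreGraph where
  V := Σ x : Λ.V, Δ.residues (D.vert x)
  E := Σ e : Λ.E, Δ.residues (D.edge e)
  o p := ⟨Λ.o p.1, Δ.resMap (D.edge_subset_o p.1) p.2⟩
  t p := ⟨Λ.t p.1, Δ.resMap (D.edge_subset p.1) p.2⟩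
  inv p := ⟨Λ.inv p.1, p.2.1, Δ.residues_inv D p.1 p.2.2⟩
  inv_inv p := Δ.sigma_residue_eq D.edge (Λ.inv_inv p.1) rfl
  inv_ne p h := Λ.inv_ne p.1 (congrArg Sigma.fst h)
  o_inv p := Δ.sigma_residue_eq D.vert (Λ.o_inv p.1)
    (Δ.resMap_val_congr _ _ (congrArg D.vert (Λ.o_inv p.1)) _ _ rfl)

/-! #### Groups acting on buildings -/

/-- The group of type-preserving automorphisms: the surjective `W`-isometries. -/
def aut₀ : Subgroup (Equiv.Perm C) where
  carrier := {g | ∀ c d, Δ.δ (g c) (g d) = Δ.δ c d}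
  one_mem' _ _ := rfl
  mul_mem' hg hh c d := (hg _ _).trans (hh c d)
  inv_mem' {g} hg c d := by simpa using (hg (g⁻¹ c) (g⁻¹ d)).symm

/-- The permutation topology on the group of type-preserving automorphisms, generated by the
left cosets of the pointwise stabilisers of finite sets of chambers. -/
instance : TopologicalSpace Δ.aut₀ :=
  .generateFrom {A | ∃ (g : Δ.aut₀) (F : Finset C), A = {h | ∀ c ∈ F, h.1 c = g.1 c}}

variable {G : Type*} [Group G] (φ : G →* Δ.aut₀)

/-- The setwise stabiliser of a set of chambers. -/
def setStabiliser (R : Set C) : Subgroup G where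
  carrier := {g | (φ g).1 '' R = R}
  one_mem' := by simp
  mul_mem' {g h} hg hh := by
    simp only [Set.mem_ofPred_eq] at hg hh ⊢
    calc (φ (g * h)).1 '' R = (φ g).1 '' ((φ h).1 '' R) := by
          rw [map_mul, Subgroup.coe_mul, Equiv.Perm.coe_mul, Set.image_comp]
      _ = R := by rw [hh, hg]
  inv_mem' {g} hg := by
    simp only [Set.mem_ofPred_eq] at hg ⊢
    calc (φ g⁻¹).1 '' R = (φ g⁻¹).1 '' ((φ g).1 '' R) := by rw [hg]
      _ = R := by rw [← Set.image_comp, ← Equiv.Perm.coe_mul, ← Subgroup.coe_mul, ← map_mul]; simp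

theorem image_res (g : G) (J : Set B) (c : C) :
    (φ g).1 '' Δ.res J c = Δ.res J ((φ g).1 c) := by
  ext d
  obtain ⟨d, rfl⟩ := (φ g).1.surjective d
  rw [(φ g).1.injective.mem_set_image]
  simp only [res, Set.mem_ofPred_eq, (φ g).2 c d]

theorem setStabiliser_mono {J K : Set B} (h : J ⊆ K) (c : C) :
    Δ.setStabiliser φ (Δ.res J c) ≤ Δ.setStabiliser φ (Δ.res K c) := by
  intro g hg
  change _ '' _ = _ at hg ⊢
  rw [image_res] at hg ⊢
  have hm : (φ g).1 c ∈ Δ.res J c := hg ▸ Δ.mem_res_self J _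
  exact (Δ.res_eq_of_mem (cs.special_mono h hm : _ ∈ Δ.res K c)).symm

/-- The graph of the stabilisers in `G` of the residues `Res_{S_λ}(c)`, with the inclusions. -/
def stabiliserGraph {Λ : SerreGraph.{u, v}} (D : SpecialData Λ B) (c : C) :
    GraphOfSubgroups Λ G where
  vert x := Δ.setStabiliser φ (Δ.res (D.vert x) c)
  edge e := Δ.setStabiliser φ (Δ.res (D.edge e) c)
  edge_inv e := by rw [D.edge_inv]
  edge_le e := Δ.setStabiliser_mono φ (D.edge_subset e) c

end Building

/-!
Every function `u` on the edges of the Bass–Serre graph that changes sign under inversion has a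
potential `h`, that is, `u = h ∘ t - h ∘ o`: solving for `h` along the maximal subtree and twisting
left translation by the values of `u`, one obtains permutations of `π₁ × A` that satisfy the
relations of `π₁`, and an orbit of the resulting action is the graph of a potential. A graph in
which the signed crossing number of every edge has a potential is a forest, since a closed path
must then cross each of its edges in both directions. So the Bass–Serre graph is a tree.

For subgroups of an ambient group `H`, the Bass–Serre graph maps to the graph of the cosets in `H`
of the vertex and edge groups by an immersion, and an immersion of a connected graph into a forest
is injective. It follows that `π₁ → H` is bijective if and only if the coset graph is a tree.

A visual decomposition therefore amounts to a tree structure on the coset graph of `W`. Seen from a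
chamber `b`, the residue graph folds onto this tree through `d ↦ δ(b, d)`, and each residue of `b`
is alone in its fibre. Pulling back crossing numbers shows that the residue graph is a forest. If
`G` is transitive on the chambers, the coset graph of the stabilisers is the residue graph, so
`π₁ → G` is bijective. The topologies agree because the stabilisers are open and, by van Dantzig's
theorem, the open subgroups of `G` form a basis of neighbourhoods of the identity.
-/

/-! ### Trees and forests -/

namespace SerreGraph

section Paths

variable {X : SerreGraph.{u, v}}

theorem isPath_append {p q : List X.E} {a c : X.V} :
    X.IsPath a (p ++ q) c ↔ ∃ b, X.IsPath a p b ∧ X.IsPath b q c := by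
  induction p generalizing a with
  | nil => simp [IsPath]
  | cons e p ih => simp [IsPath, ih, and_assoc]

variable (X) in
/-- Two vertices are reachable from each other if a path joins them. -/
def Reachable (a b : X.V) : Prop :=
  ∃ p, X.IsPath a p b

theorem reachable_o_t (e : X.E) : X.Reachable (X.o e) (X.t e) :=
  ⟨[e], rfl, rfl⟩

theorem Reachable.refl (a : X.V) : X.Reachable a a :=
  ⟨[], rfl⟩

theorem Reachable.trans {a b c : X.V} : X.Reachable a b → X.Reachable b c → X.Reachable a c :=
  fun ⟨p, hp⟩ ⟨q, hq⟩ => ⟨p ++ q, isPath_append.2 ⟨b, hp, hq⟩⟩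

theorem Reachable.symm {a b : X.V} (h : X.Reachable a b) : X.Reachable b a := by
  obtain ⟨p, hp⟩ := h
  induction p generalizing a with
  | nil => exact hp ▸ .refl a
  | cons e p ih =>
    obtain ⟨rfl, hp⟩ := hp
    have h : X.Reachable (X.t e) (X.o e) := by
      simpa only [X.o_inv, X.t_inv] using reachable_o_t (X.inv e)
    exact (ih hp).trans h

theorem Reachable.apply_eq {α : Type*} {f : X.V → α} (hf : ∀ e, f (X.t e) = f (X.o e))
    {a b : X.V} (h : X.Reachable a b) : f a = f b := by
  obtain ⟨p, hp⟩ := h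
  induction p generalizing a with
  | nil => exact congrArg f hp
  | cons e p ih =>
    obtain ⟨rfl, hp⟩ := hp
    rw [← hf, ih hp]

theorem exists_eq_append_of_not_isReduced {p : List X.E} {a b : X.V} (hp : X.IsPath a p b)
    (hr : ¬X.IsReduced p) :
    ∃ q e r, p = q ++ e :: X.inv e :: r ∧ X.IsPath a (q ++ r) b := by
  rw [IsReduced, List.isChain_iff_forall_rel_of_append_cons_cons] at hr
  push Not at hr
  obtain ⟨e, _, q, r, rfl, rfl⟩ := hr
  obtain ⟨_, hq, rfl, -, hr⟩ := isPath_append.1 hp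
  exact ⟨q, e, r, rfl, isPath_append.2 ⟨_, hq, X.t_inv e ▸ hr⟩⟩

theorem Reachable.exists_isReduced {a b : X.V} (h : X.Reachable a b) :
    ∃ p, X.IsPath a p b ∧ X.IsReduced p := by
  obtain ⟨p, hp⟩ := h
  induction hn : p.length using Nat.strong_induction_on generalizing p with
  | h n ih =>
    by_cases hr : X.IsReduced p
    · exact ⟨p, hp, hr⟩
    · obtain ⟨q, e, r, rfl, hqr⟩ := exists_eq_append_of_not_isReduced hp hr
      exact ih _ (by simp +arith [← hn]) _ hqr rfl

variable (X) in
/-- A graph without closed path without backtracking of positive length. -/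
def IsForest : Prop :=
  ∀ a p, X.IsPath a p a → X.IsReduced p → p = []

end Paths

section Potentials

variable {X : SerreGraph.{u, v}} {A : Type*} [AddGroup A] {u : X.E → A}

theorem IsPath.add_sum_map {h : X.V → A} (hu : ∀ e, h (X.t e) = h (X.o e) + u e)
    {a b : X.V} {p : List X.E} (hp : X.IsPath a p b) : h a + (p.map u).sum = h b := by
  induction p generalizing a with
  | nil => simpa using congrArg h hp
  | cons e p ih =>
    obtain ⟨rfl, hp⟩ := hp
    rw [List.map_cons, List.sum_cons, ← add_assoc, ← hu, ih hp]

theorem IsForest.sum_map_eq_zero (hX : X.IsForest) (hu : ∀ e, u (X.inv e) = -u e)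
    {a : X.V} {p : List X.E} (hp : X.IsPath a p a) : (p.map u).sum = 0 := by
  induction hn : p.length using Nat.strong_induction_on generalizing p with
  | h n ih =>
    by_cases hr : X.IsReduced p
    · simp [hX a p hp hr]
    · obtain ⟨q, e, r, rfl, hqr⟩ := exists_eq_append_of_not_isReduced hp hr
      simpa [hu] using ih _ (by simp +arith [← hn]) hqr rfl

theorem IsTree.exists_potential (hX : X.IsTree) (hu : ∀ e, u (X.inv e) = -u e) :
    ∃ h : X.V → A, ∀ e, h (X.t e) = h (X.o e) + u e := by
  obtain ⟨⟨⟨a⟩, hconn⟩, hforest⟩ := hX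
  choose p hp using hconn a
  choose q hq using fun b => hconn b a
  have sum_eq_neg {r : List X.E} {b : X.V} (hr : X.IsPath a r b) :
      (r.map u).sum = -((q b).map u).sum := by
    have h := IsForest.sum_map_eq_zero hforest hu (isPath_append.2 ⟨b, hr, hq b⟩)
    rw [List.map_append, List.sum_append] at h
    exact eq_neg_of_add_eq_zero_left h
  refine ⟨fun b => ((p b).map u).sum, fun e => ?_⟩
  have hpe : X.IsPath a (p (X.o e) ++ [e]) (X.t e) := isPath_append.2 ⟨_, hp _, rfl, rfl⟩
  simpa [sum_eq_neg (hp (X.t e))] using (sum_eq_neg hpe).symm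

open Classical in
/-- The signed number of times that traversing the edge `f` traverses `e` or its inverse. Forests
are recognised by potentials for these functions. -/
noncomputable def crossing (e f : X.E) : ℤ :=
  (if f = e then 1 else 0) - (if f = X.inv e then 1 else 0)

theorem crossing_self (e : X.E) : crossing e e = 1 := by
  simp [crossing, (X.inv_ne e).symm]

theorem crossing_nonneg {e f : X.E} (h : f ≠ X.inv e) : 0 ≤ crossing e f := by
  rw [crossing, if_neg h, sub_zero]
  split_ifs <;> simp

theorem inv_eq_iff {e f : X.E} : X.inv e = f ↔ e = X.inv f :=
  ⟨fun h => h ▸ (X.inv_inv e).symm, fun h => h ▸ X.inv_inv f⟩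

theorem crossing_inv (e f : X.E) : crossing e (X.inv f) = -crossing e f := by
  classical simp only [crossing, inv_eq_iff, inv_inv, neg_sub]

theorem mem_of_sum_crossing_eq_zero {e : X.E} {p : List X.E}
    (h : ((e :: p).map (crossing e)).sum = 0) : X.inv e ∈ p := by
  by_contra he
  have hp : 0 ≤ (p.map (crossing e)).sum := by
    refine List.sum_nonneg fun n hn => ?_
    obtain ⟨f, hf, rfl⟩ := List.mem_map.1 hn
    exact crossing_nonneg fun hfe => he (hfe ▸ hf)
  rw [List.map_cons, List.sum_cons, crossing_self] at h
  lia

theorem isForest_of_exists_potential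
    (hX : ∀ e, ∃ h : X.V → ℤ, ∀ f, h (X.t f) = h (X.o f) + crossing e f) : X.IsForest := by
  intro a p hp hr
  induction hn : p.length using Nat.strong_induction_on generalizing a p with
  | h n ih =>
    rcases p with _ | ⟨e, p⟩
    · rfl
    obtain ⟨h, hh⟩ := hX e
    obtain ⟨q, r, rfl⟩ := List.append_of_mem
      (mem_of_sum_crossing_eq_zero (add_eq_left.1 (hp.add_sum_map hh)))
    obtain ⟨b, hq, hb, -⟩ := isPath_append.1 hp.2
    obtain rfl : X.t e = b := X.o_inv e ▸ hb
    have hq_reduced : X.IsReduced q := hr.tail.left_of_append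
    obtain rfl : q = [] := ih _ (by simp +arith [← hn]) _ q hq hq_reduced rfl
    exact absurd rfl (List.isChain_cons_cons.1 hr).1

end Potentials

/-- Morphisms of graphs. -/
structure Hom (X : SerreGraph) (Y : SerreGraph) where
  onV : X.V → Y.V
  onE : X.E → Y.E
  map_o : ∀ e, onV (X.o e) = Y.o (onE e)
  map_inv : ∀ e, onE (X.inv e) = Y.inv (onE e)

namespace Hom

variable {X Y : SerreGraph} (F : Hom X Y)

theorem map_t (e : X.E) : F.onV (X.t e) = Y.t (F.onE e) := by
  rw [← X.o_inv, F.map_o, F.map_inv, Y.o_inv]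

theorem isPath_map {a b : X.V} {p : List X.E} (hp : X.IsPath a p b) :
    Y.IsPath (F.onV a) (p.map F.onE) (F.onV b) := by
  induction p generalizing a with
  | nil => exact congrArg F.onV hp
  | cons e p ih => exact ⟨hp.1 ▸ (F.map_o e).symm, F.map_t e ▸ ih hp.2⟩

theorem reachable_map {a b : X.V} : X.Reachable a b → Y.Reachable (F.onV a) (F.onV b) :=
  fun ⟨p, hp⟩ => ⟨p.map F.onE, F.isPath_map hp⟩

theorem isForest_of_exists_fiber_eq (hY : Y.IsTree)
    (hF : ∀ e, ∃ F : Hom X Y, ∀ f, F.onE f = F.onE e → f = e) : X.IsForest := by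
  refine isForest_of_exists_potential fun e => ?_
  obtain ⟨F, hF⟩ := hF e
  obtain ⟨h, hh⟩ := hY.exists_potential (crossing_inv (F.onE e))
  have onE_eq_iff (f) : F.onE f = F.onE e ↔ f = e := ⟨hF f, congrArg F.onE⟩
  have onE_eq_inv_iff (f) : F.onE f = Y.inv (F.onE e) ↔ f = X.inv e := by
    rw [← inv_eq_iff, ← F.map_inv, onE_eq_iff, inv_eq_iff]
  refine ⟨fun a => h (F.onV a), fun f => ?_⟩
  classical simp only [F.map_t, F.map_o, hh, crossing, onE_eq_iff, onE_eq_inv_iff]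

/-- A morphism is an immersion if it is injective on the edges that end at any given vertex. -/
def IsImmersion : Prop :=
  ∀ e f, X.t e = X.t f → F.onE e = F.onE f → e = f

variable {F}

theorem IsImmersion.isReduced_map (hF : F.IsImmersion) {p : List X.E} {a b : X.V}
    (hp : X.IsPath a p b) (hr : X.IsReduced p) : Y.IsReduced (p.map F.onE) := by
  induction p generalizing a with
  | nil => exact .nil
  | cons e p ih =>
    cases p with
    | nil => exact .singleton _
    | cons f p =>
      refine .cons_cons (fun h => ?_) (ih hp.2 hr.tail)
      refine (List.isChain_cons_cons.1 hr).1 (inv_eq_iff.1 (hF _ _ ?_ ?_))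
      · rw [X.t_inv, hp.2.1]
      · rw [F.map_inv, h, Y.inv_inv]

theorem IsImmersion.isForest (hF : F.IsImmersion) (hY : Y.IsForest) : X.IsForest :=
  fun _ _ hp hr => List.map_eq_nil_iff.1 (hY _ _ (F.isPath_map hp) (hF.isReduced_map hp hr))

theorem IsImmersion.injective_onV (hF : F.IsImmersion) (hX : X.IsConnected)
    (hY : Y.IsForest) : Function.Injective F.onV := by
  intro a b hab
  obtain ⟨p, hp, hr⟩ := Reachable.exists_isReduced (hX.2 a b)
  have hnil := hY _ _ (hab ▸ F.isPath_map hp) (hF.isReduced_map hp hr)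
  obtain rfl := List.map_eq_nil_iff.1 hnil
  exact hp

/-- A morphism that is bijective on vertices and on edges, as an isomorphism. -/
noncomputable def toIso (F : Hom X Y) (hV : Function.Bijective F.onV)
    (hE : Function.Bijective F.onE) : Iso X Y where
  onV := .ofBijective F.onV hV
  onE := .ofBijective F.onE hE
  map_o := F.map_o
  map_t := F.map_t
  map_inv := F.map_inv

end Hom

namespace Iso

variable {X Y Z : SerreGraph}

/-- The composite of two isomorphisms. -/
def trans (F : Iso X Y) (F' : Iso Y Z) : Iso X Z where
  onV := F.onV.trans F'.onV
  onE := F.onE.trans F'.onE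
  map_o e := by rw [Equiv.trans_apply, Equiv.trans_apply, F.map_o, F'.map_o]
  map_t e := by rw [Equiv.trans_apply, Equiv.trans_apply, F.map_t, F'.map_t]
  map_inv e := by rw [Equiv.trans_apply, Equiv.trans_apply, F.map_inv, F'.map_inv]

/-- The inverse of an isomorphism. -/
def symm (F : Iso X Y) : Iso Y X where
  onV := F.onV.symm
  onE := F.onE.symm
  map_o e := by rw [Equiv.symm_apply_eq, F.map_o, Equiv.apply_symm_apply]
  map_t e := by rw [Equiv.symm_apply_eq, F.map_t, Equiv.apply_symm_apply]
  map_inv e := by rw [Equiv.symm_apply_eq, F.map_inv, Equiv.apply_symm_apply]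

/-- The morphism underlying an isomorphism. -/
@[simps]
def toHom (F : Iso X Y) : Hom X Y where
  onV := F.onV
  onE := F.onE
  map_o := F.map_o
  map_inv := F.map_inv

theorem isTree (F : Iso X Y) (hX : X.IsTree) : Y.IsTree := by
  have himm : F.symm.toHom.IsImmersion := fun _ _ _ h => F.symm.onE.injective h
  obtain ⟨⟨⟨a⟩, hconn⟩, hforest⟩ := hX
  refine ⟨⟨⟨F.onV a⟩, fun b c => ?_⟩, himm.isForest hforest⟩
  simpa [Reachable] using F.toHom.reachable_map (hconn (F.onV.symm b) (F.onV.symm c))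

end Iso

end SerreGraph

/-! ### The fundamental group and the Bass–Serre tree -/

namespace GraphOfSubgroups

variable {Λ : SerreGraph.{u, v}} {H : Type w} [Group H] (𝒢 : GraphOfSubgroups Λ H)

section Generators

variable (T : Set Λ.E)

/-- The universal property of the fundamental group: homomorphisms on the vertex groups and values
on the edges that respect the relators define a homomorphism. -/
def lift {K : Type*} [Group K] (f : ∀ x, 𝒢.vert x →* K) (η : Λ.E → K)
    (hinv : ∀ e, η e * η (Λ.inv e) = 1)
    (hconj : ∀ e (a : 𝒢.edge e), η e * f (Λ.t e) (Subgroup.inclusion (𝒢.edge_le e) a) *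
      (η e)⁻¹ = f (Λ.o e) (Subgroup.inclusion (𝒢.edge_le_o e) a))
    (hT : ∀ e ∈ T, η e = 1) : 𝒢.Pi1 T →* K :=
  QuotientGroup.lift (Subgroup.normalClosure {r | 𝒢.Relator T r})
    (Monoid.Coprod.lift (Monoid.CoprodI.lift f) (FreeGroup.lift η)) fun _ h =>
    (Subgroup.normalClosure_le_normal
      (N := (Monoid.Coprod.lift (Monoid.CoprodI.lift f) (FreeGroup.lift η)).ker) fun _ hr => by
        rcases hr with e | ⟨e, a⟩ | ⟨e, he⟩
        · simpa [preEdge, MonoidHom.mem_ker] using hinv e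
        · simpa [preEdge, preVert, MonoidHom.mem_ker, mul_inv_eq_one] using hconj e a
        · simpa [preEdge, MonoidHom.mem_ker] using hT e he) h

variable {K : Type*} [Group K] (f : ∀ x, 𝒢.vert x →* K) (η : Λ.E → K)
    (hinv : ∀ e, η e * η (Λ.inv e) = 1)
    (hconj : ∀ e (a : 𝒢.edge e), η e * f (Λ.t e) (Subgroup.inclusion (𝒢.edge_le e) a) *
      (η e)⁻¹ = f (Λ.o e) (Subgroup.inclusion (𝒢.edge_le_o e) a))
    (hT : ∀ e ∈ T, η e = 1)

theorem lift_ofVert (x : Λ.V) (a : 𝒢.vert x) :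
    𝒢.lift T f η hinv hconj hT (𝒢.ofVert T x a) = f x a :=
  show Monoid.Coprod.lift (Monoid.CoprodI.lift f) (FreeGroup.lift η) (𝒢.preVert x a) = f x a by
    simp [preVert]

theorem lift_ofEdge (e : Λ.E) : 𝒢.lift T f η hinv hconj hT (𝒢.ofEdge T e) = η e :=
  show Monoid.Coprod.lift (Monoid.CoprodI.lift f) (FreeGroup.lift η) (𝒢.preEdge e) = η e by
    simp [preEdge]

@[simp]
theorem toAmbient_ofVert (x : Λ.V) (a : 𝒢.vert x) : 𝒢.toAmbient T (𝒢.ofVert T x a) = a :=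
  show 𝒢.preToAmbient (𝒢.preVert x a) = a by simp [preToAmbient, preVert]

@[simp]
theorem toAmbient_ofEdge (e : Λ.E) : 𝒢.toAmbient T (𝒢.ofEdge T e) = 1 :=
  show 𝒢.preToAmbient (𝒢.preEdge e) = 1 by simp [preToAmbient, preEdge]

theorem closure_ofVert_ofEdge : Subgroup.closure
    ({γ | ∃ x a, 𝒢.ofVert T x a = γ} ∪ Set.range (𝒢.ofEdge T)) = ⊤ := by
  refine eq_top_iff.2 fun γ _ => ?_
  obtain ⟨γ, rfl⟩ : ∃ γ', 𝒢.toPi1 T γ' = γ := QuotientGroup.mk'_surjective _ γ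
  induction γ using Monoid.Coprod.induction_on with
  | inl γ =>
    induction γ using Monoid.CoprodI.induction_on with
    | one => simp only [map_one, one_mem]
    | of x a => exact Subgroup.subset_closure (.inl ⟨x, a, rfl⟩)
    | mul γ γ' hγ hγ' => simpa only [map_mul] using mul_mem (hγ trivial) (hγ' trivial)
  | inr γ =>
    induction γ using FreeGroup.induction_on with
    | C1 => simp only [map_one, one_mem]
    | of e => exact Subgroup.subset_closure (.inr ⟨e, rfl⟩)
    | inv_of e he => simpa only [map_inv] using inv_mem (he trivial)
    | mul γ γ' hγ hγ' => simpa only [map_mul] using mul_mem (hγ trivial) (hγ' trivial)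
  | mul γ γ' hγ hγ' => simpa only [map_mul] using mul_mem (hγ trivial) (hγ' trivial)

variable {T} in
theorem induction_on_right {P : 𝒢.Pi1 T → Prop} (one : P 1)
    (mul_ofVert : ∀ γ x a, P γ → P (γ * 𝒢.ofVert T x a))
    (mul_ofEdge : ∀ γ e, P γ → P (γ * 𝒢.ofEdge T e)) (γ : 𝒢.Pi1 T) : P γ := by
  have hγ : γ ∈ Subgroup.closure _ := 𝒢.closure_ofVert_ofEdge T ▸ Subgroup.mem_top γ
  induction hγ using Subgroup.closure_induction_right with
  | one => exact one
  | mul_right γ _ _ hs ih =>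
    rcases hs with ⟨x, a, rfl⟩ | ⟨e, rfl⟩
    · exact mul_ofVert _ _ _ ih
    · exact mul_ofEdge _ _ ih
  | mul_inv_cancel γ _ _ hs ih =>
    rcases hs with ⟨x, a, rfl⟩ | ⟨e, rfl⟩
    · simpa only [map_inv] using mul_ofVert _ _ a⁻¹ ih
    · simpa only [ofEdge_inv] using mul_ofEdge _ (Λ.inv e) ih

theorem range_toAmbient : (𝒢.toAmbient T).range = ⨆ x, 𝒢.vert x := by
  refine le_antisymm ?_ (iSup_le fun x a ha => ⟨𝒢.ofVert T x ⟨a, ha⟩, by simp⟩)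
  rintro _ ⟨γ, rfl⟩
  induction γ using 𝒢.induction_on_right with
  | one => simp only [map_one, one_mem]
  | mul_ofVert γ x a ih =>
    rw [map_mul, toAmbient_ofVert]
    exact mul_mem ih (Subgroup.mem_iSup_of_mem x a.2)
  | mul_ofEdge γ e ih => simpa using ih

theorem ofEdge_eq_one {e : Λ.E} (he : e ∈ T) : 𝒢.ofEdge T e = 1 :=
  𝒢.toPi1_relator T (.tree e he)

end Generators

section Connected

variable {T : Set Λ.E}

variable (T) in
/-- The translate by `γ` of the lift to the Bass–Serre graph of a morphism to `Λ` along which all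
edge elements of the fundamental group are trivial. -/
def liftHom {X : SerreGraph} (F : SerreGraph.Hom X Λ) (hF : ∀ e, 𝒢.ofEdge T (F.onE e) = 1)
    (γ : 𝒢.Pi1 T) : SerreGraph.Hom X (𝒢.bassSerreGraph T) where
  onV x := ⟨F.onV x, γ⟩
  onE e := ⟨F.onE e, γ⟩
  map_o e := 𝒢.sigma_mk_eq T _ (F.map_o e) (by simp [hF])
  map_inv e := 𝒢.sigma_mk_eq T _ (F.map_inv e) (by simp [hF])

theorem reachable_mk_mk (hT : Λ.IsMaximalTree T) (x y : Λ.V) (γ : 𝒢.Pi1 T) :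
    (𝒢.bassSerreGraph T).Reachable ⟨x, γ⟩ ⟨y, γ⟩ := by
  obtain ⟨hinv, hconn, -⟩ := hT
  let F : SerreGraph.Hom (Λ.spanningSubgraph T hinv) Λ :=
    ⟨id, Subtype.val, fun _ => rfl, fun _ => rfl⟩
  exact (𝒢.liftHom T F (fun e => 𝒢.ofEdge_eq_one T e.2) γ).reachable_map (hconn.2 x y)

theorem bassSerreGraph_isConnected (hT : Λ.IsMaximalTree T) :
    (𝒢.bassSerreGraph T).IsConnected := by
  obtain ⟨x₀⟩ : Nonempty Λ.V := hT.2.1.1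
  have reachable (γ : 𝒢.Pi1 T) (y : Λ.V) :
      (𝒢.bassSerreGraph T).Reachable ⟨x₀, (1 : 𝒢.Pi1 T)⟩ ⟨y, γ⟩ := by
    induction γ using 𝒢.induction_on_right generalizing y with
    | one => exact 𝒢.reachable_mk_mk hT x₀ y 1
    | mul_ofVert γ x a ih =>
      have h := ih x
      rw [← QuotientGroup.mk_mul_of_mem γ (⟨a, rfl⟩ : 𝒢.ofVert T x a ∈ 𝒢.vertImage T x)] at h
      exact h.trans (𝒢.reachable_mk_mk hT x y _)
    | mul_ofEdge γ e ih =>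
      have h := SerreGraph.reachable_o_t (X := 𝒢.bassSerreGraph T) ⟨Λ.inv e, γ⟩
      have ho : (𝒢.bassSerreGraph T).o ⟨Λ.inv e, γ⟩ = ⟨_, ↑(γ * 𝒢.ofEdge T e)⟩ :=
        𝒢.sigma_mk_eq T _ rfl (by simp [ofEdge_inv])
      rw [ho] at h
      exact ((ih _).trans h.symm).trans (𝒢.reachable_mk_mk hT _ y _)
  refine ⟨⟨⟨x₀, (1 : 𝒢.Pi1 T)⟩⟩, ?_⟩
  rintro ⟨x, ⟨γ⟩⟩ ⟨y, ⟨γ'⟩⟩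
  exact (reachable γ x).symm.trans (reachable γ' y)

end Connected

end GraphOfSubgroups

/-! ### Potentials on the Bass–Serre graph -/

namespace Shear

variable {P A : Type*}

section AddGroup

variable [AddGroup A]

/-- The permutation `(g, s) ↦ (g, s + S g)` of `P × A`. -/
def shear (S : P → A) : Equiv.Perm (P × A) :=
  Equiv.prodShear (Equiv.refl P) fun g => Equiv.addRight (S g)

theorem shear_apply (S : P → A) (z : P × A) : shear S z = (z.1, z.2 + S z.1) := rfl

theorem shear_symm_apply (S : P → A) (z : P × A) : (shear S).symm z = (z.1, z.2 - S z.1) := by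
  simp [Equiv.symm_apply_eq, shear_apply]

end AddGroup

variable [Group P]

variable (P A) in
/-- The action of `P` on `P × A` through left multiplication on the first factor. -/
def leftTranslation : P →* Equiv.Perm (P × A) where
  toFun γ := Equiv.prodCongr (Equiv.mulLeft γ) (Equiv.refl A)
  map_one' := by ext <;> simp
  map_mul' γ γ' := by ext <;> simp [mul_assoc]

theorem leftTranslation_apply (γ : P) (z : P × A) : leftTranslation P A γ z = (γ * z.1, z.2) := rfl

theorem leftTranslation_mul_shear [AddGroup A] {S S' : P → A} {γ : P} (h : ∀ g, S' (γ * g) = S g) :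
    leftTranslation P A γ * shear S = shear S' * leftTranslation P A γ := by
  ext z <;> simp [leftTranslation_apply, shear_apply, h]

end Shear

namespace GraphOfSubgroups

open Shear

variable {Λ : SerreGraph.{u, v}} {H : Type w} [Group H] {𝒢 : GraphOfSubgroups Λ H} {T : Set Λ.E}
  {A : Type*} {u : (𝒢.bassSerreGraph T).E → A}

/-- A function on the edges of the Bass–Serre graph, read off for each edge of `Λ` as a function on
the fundamental group. The inverse turns the cosets `g 𝒢_e` into cosets on the left. -/
def edgeWeight (u : (𝒢.bassSerreGraph T).E → A) (e : Λ.E) (g : 𝒢.Pi1 T) : A :=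
  u ⟨e, (g⁻¹ : 𝒢.Pi1 T)⟩

theorem edgeWeight_mul {e : Λ.E} {γ : 𝒢.Pi1 T} (hγ : γ ∈ 𝒢.edgeImage T e) (g : 𝒢.Pi1 T) :
    edgeWeight u e (γ * g) = edgeWeight u e g := by
  rw [edgeWeight, mul_inv_rev, QuotientGroup.mk_mul_of_mem _ (inv_mem hγ), edgeWeight]

variable [AddGroup A]

theorem edgeWeight_inv (hu : ∀ q, u ((𝒢.bassSerreGraph T).inv q) = -u q) (e : Λ.E)
    (g : 𝒢.Pi1 T) : edgeWeight u (Λ.inv e) (𝒢.ofEdge T e * g) = -edgeWeight u e g := by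
  rw [edgeWeight, mul_inv_rev]
  exact hu ⟨e, (g⁻¹ : 𝒢.Pi1 T)⟩

theorem exists_potential_on_tree (hT : Λ.IsMaximalTree T)
    (hu : ∀ q, u ((𝒢.bassSerreGraph T).inv q) = -u q) :
    ∃ S : Λ.V → 𝒢.Pi1 T → A, ∀ e ∈ T, ∀ g, S (Λ.t e) g = S (Λ.o e) g + edgeWeight u e g := by
  obtain ⟨hinv, htree⟩ := hT
  have exists_potential (g : 𝒢.Pi1 T) :
      ∃ h : Λ.V → A, ∀ e : T, h (Λ.t e) = h (Λ.o e) + edgeWeight u e g := by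
    refine htree.exists_potential (u := fun e => edgeWeight u (Subtype.val e) g) fun e => ?_
    rw [← edgeWeight_inv hu, 𝒢.ofEdge_eq_one T (Subtype.prop e), one_mul]
    rfl
  choose S hS using exists_potential
  exact ⟨fun x g => S g x, fun e he g => hS g ⟨e, he⟩⟩

theorem exists_holonomy (hu : ∀ q, u ((𝒢.bassSerreGraph T).inv q) = -u q)
    {S : Λ.V → 𝒢.Pi1 T → A}
    (hS : ∀ e ∈ T, ∀ g, S (Λ.t e) g = S (Λ.o e) g + edgeWeight u e g) :
    ∃ Θ : 𝒢.Pi1 T →* Equiv.Perm (𝒢.Pi1 T × A),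
      (∀ x a, Θ (𝒢.ofVert T x a) =
        (shear (S x))⁻¹ * leftTranslation _ A (𝒢.ofVert T x a) * shear (S x)) ∧
      ∀ e, Θ (𝒢.ofEdge T e) = (shear (S (Λ.o e)))⁻¹ * leftTranslation _ A (𝒢.ofEdge T e) *
        (shear (edgeWeight u e))⁻¹ * shear (S (Λ.t e)) := by
  let f (x : Λ.V) : 𝒢.vert x →* Equiv.Perm (𝒢.Pi1 T × A) :=
    (MulAut.conj (shear (S x))⁻¹).toMonoidHom.comp ((leftTranslation _ A).comp (𝒢.ofVert T x))
  have f_apply (x) (a : 𝒢.vert x) : f x a =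
      (shear (S x))⁻¹ * leftTranslation _ A (𝒢.ofVert T x a) * shear (S x) := by
    simp [f]
  let η (e : Λ.E) : Equiv.Perm (𝒢.Pi1 T × A) :=
    (shear (S (Λ.o e)))⁻¹ * leftTranslation _ A (𝒢.ofEdge T e) *
        (shear (edgeWeight u e))⁻¹ * shear (S (Λ.t e))
  have hη_inv (e) : η e * η (Λ.inv e) = 1 := by
    have h : leftTranslation _ A (𝒢.ofEdge T e) =
        shear (edgeWeight u (Λ.inv e)) * leftTranslation _ A (𝒢.ofEdge T e) *
          shear (edgeWeight u e) := by
      ext z <;> simp [leftTranslation_apply, shear_apply, edgeWeight_inv hu]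
    simp only [η, Λ.o_inv, Λ.t_inv, ofEdge_inv, map_inv]
    nth_rw 1 [h]
    group
  have hη_conj (e) (a : 𝒢.edge e) :
      η e * f (Λ.t e) (Subgroup.inclusion (𝒢.edge_le e) a) * (η e)⁻¹ =
        f (Λ.o e) (Subgroup.inclusion (𝒢.edge_le_o e) a) := by
    rw [f_apply, f_apply, ← ofEdge_conj]
    set a' := 𝒢.ofVert T (Λ.t e) (Subgroup.inclusion (𝒢.edge_le e) a)
    have ha' : a' ∈ 𝒢.edgeImage T e := ⟨a, rfl⟩
    have h : leftTranslation _ A a' =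
        (shear (edgeWeight u e))⁻¹ * leftTranslation _ A a' * shear (edgeWeight u e) := by
      rw [mul_assoc, leftTranslation_mul_shear (edgeWeight_mul ha'), inv_mul_cancel_left]
    simp only [η, map_mul, map_inv]
    conv_rhs => rw [h]
    group
  have hη_tree (e) (he : e ∈ T) : η e = 1 := by
    have h : shear (S (Λ.t e)) = shear (edgeWeight u e) * shear (S (Λ.o e)) := by
      ext z <;> simp [shear_apply, hS e he, add_assoc]
    simp [η, h, 𝒢.ofEdge_eq_one T he]
  exact ⟨𝒢.lift T f η hη_inv hη_conj hη_tree, fun x a => by rw [lift_ofVert, f_apply],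
    fun e => by rw [lift_ofEdge]⟩

theorem exists_potential (hT : Λ.IsMaximalTree T)
    (hu : ∀ q, u ((𝒢.bassSerreGraph T).inv q) = -u q) :
    ∃ h : (𝒢.bassSerreGraph T).V → A, ∀ q,
      h ((𝒢.bassSerreGraph T).t q) = h ((𝒢.bassSerreGraph T).o q) + u q := by
  obtain ⟨S, hS⟩ := exists_potential_on_tree hT hu
  obtain ⟨Θ, hΘ_vert, hΘ_edge⟩ := exists_holonomy hu hS
  have Θ_fst (γ z) : (Θ γ z).1 = γ * z.1 := by
    induction γ using 𝒢.induction_on_right generalizing z with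
    | one => simp
    | mul_ofVert γ x a ih =>
      simp [ih, hΘ_vert, leftTranslation_apply, shear_apply, shear_symm_apply, mul_assoc]
    | mul_ofEdge γ e ih =>
      simp [ih, hΘ_edge, leftTranslation_apply, shear_apply, shear_symm_apply, mul_assoc]
  let developed (x : Λ.V) (γ : 𝒢.Pi1 T) : A := (shear (S x) (Θ γ⁻¹ (1, 0))).2
  have developed_mul (x γ a) : developed x (γ * 𝒢.ofVert T x a) = developed x γ := by
    simp [developed, ← map_inv, hΘ_vert, leftTranslation_apply]
  have developed_edge (e γ) : developed (Λ.t e) γ =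
      developed (Λ.o e) (γ * (𝒢.ofEdge T e)⁻¹) + u ⟨e, γ⟩ := by
    simp [developed, -map_inv, hΘ_edge, leftTranslation_apply, shear_symm_apply, shear_apply,
      edgeWeight, Θ_fst]
  refine ⟨fun q => Quotient.liftOn' q.2 (developed q.1) fun γ γ' h => ?_, ?_⟩
  · obtain ⟨a, ha⟩ := QuotientGroup.leftRel_apply.1 h
    rw [← developed_mul q.1 γ a, ha, mul_inv_cancel_left]
  · rintro ⟨e, ⟨γ⟩⟩
    exact developed_edge e γ

theorem bassSerreGraph_isTree (hT : Λ.IsMaximalTree T) : (𝒢.bassSerreGraph T).IsTree :=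
  ⟨𝒢.bassSerreGraph_isConnected hT, SerreGraph.isForest_of_exists_potential fun e =>
    exists_potential hT (SerreGraph.crossing_inv e)⟩

end GraphOfSubgroups

/-! ### Coset graphs -/

section Cosets

variable {G H : Type*} [Group G] [Group H]

theorem sigma_coset_eq_iff {ι : Type*} (K : ι → Subgroup H) {i j : ι} {g g' : H} :
    (⟨i, (g : H ⧸ K i)⟩ : Σ i, H ⧸ K i) = ⟨j, (g' : H ⧸ K j)⟩ ↔ i = j ∧ g⁻¹ * g' ∈ K i := by
  constructor
  · intro h
    obtain rfl : i = j := congrArg Sigma.fst h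
    exact ⟨rfl, QuotientGroup.eq.1 (eq_of_heq (Sigma.mk.inj_iff.1 h).2)⟩
  · rintro ⟨rfl, h⟩
    rw [QuotientGroup.eq.2 h]

/-- The map between coset spaces induced by a homomorphism. -/
def cosetMap (f : G →* H) {K : Subgroup G} {L : Subgroup H} (h : K ≤ L.comap f) : G ⧸ K → H ⧸ L :=
  Quotient.map' f fun g g' hg => by
    rw [QuotientGroup.leftRel_apply] at hg ⊢
    simpa using h hg

theorem bijective_sigma_map_cosetMap {ι : Type*} {f : G →* H} (hf : Function.Surjective f)
    {K : ι → Subgroup G} {L : ι → Subgroup H} (h : ∀ i, K i = (L i).comap f) :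
    Function.Bijective
      (Sigma.map id fun i => cosetMap f (h i).le : (Σ i, G ⧸ K i) → Σ i, H ⧸ L i) := by
  constructor
  · rintro ⟨i, ⟨g⟩⟩ ⟨j, ⟨g'⟩⟩ hgg'
    obtain ⟨hij, hmem⟩ := (sigma_coset_eq_iff L).1 hgg'
    exact (sigma_coset_eq_iff K).2 ⟨hij, by rw [h]; simpa using hmem⟩
  · rintro ⟨i, ⟨y⟩⟩
    obtain ⟨g, rfl⟩ := hf y
    exact ⟨⟨i, g⟩, rfl⟩

end Cosets

namespace GraphOfSubgroups

variable {Λ : SerreGraph.{u, v}} {H : Type w} [Group H] (𝒢 : GraphOfSubgroups Λ H)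

/-- The coset graph of a graph of subgroups of `H`: its vertices and edges are the left cosets
in `H` of the vertex and edge groups, and incidence is inclusion of cosets. -/
def cosetGraph : SerreGraph where
  V := Σ x : Λ.V, H ⧸ 𝒢.vert x
  E := Σ e : Λ.E, H ⧸ 𝒢.edge e
  o p := ⟨Λ.o p.1, Subgroup.quotientMapOfLE (𝒢.edge_le_o p.1) p.2⟩
  t p := ⟨Λ.t p.1, Subgroup.quotientMapOfLE (𝒢.edge_le p.1) p.2⟩
  inv p := ⟨Λ.inv p.1, Subgroup.quotientMapOfLE (𝒢.edge_inv p.1).ge p.2⟩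
  inv_inv := by
    rintro ⟨e, ⟨g⟩⟩
    exact (sigma_coset_eq_iff 𝒢.edge).2 ⟨Λ.inv_inv e, by simp⟩
  inv_ne p h := Λ.inv_ne p.1 (congrArg Sigma.fst h)
  o_inv := by
    rintro ⟨e, ⟨g⟩⟩
    exact (sigma_coset_eq_iff 𝒢.vert).2 ⟨Λ.o_inv e, by simp⟩

/-- The subgroups `𝒢_λ` themselves form a copy of `Λ` in the coset graph. -/
def toCosetGraph : SerreGraph.Hom Λ 𝒢.cosetGraph where
  onV x := ⟨x, (1 : H)⟩
  onE e := ⟨e, (1 : H)⟩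
  map_o _ := rfl
  map_inv _ := rfl

theorem isForest_of_isForest_cosetGraph (h : 𝒢.cosetGraph.IsForest) : Λ.IsForest :=
  have himm : 𝒢.toCosetGraph.IsImmersion := fun _ _ _ hef => congrArg Sigma.fst hef
  himm.isForest h

theorem iSup_vert_eq_top (h : 𝒢.cosetGraph.IsConnected) : ⨆ x, 𝒢.vert x = ⊤ := by
  obtain ⟨⟨x, -⟩, hconn⟩ := h
  let toQuotient (q : 𝒢.cosetGraph.V) : H ⧸ ⨆ x, 𝒢.vert x :=
    Subgroup.quotientMapOfLE (le_iSup 𝒢.vert q.1) q.2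
  have toQuotient_t : ∀ q, toQuotient (𝒢.cosetGraph.t q) = toQuotient (𝒢.cosetGraph.o q) := by
    rintro ⟨e, ⟨g⟩⟩
    rfl
  refine eq_top_iff.2 fun g _ => ?_
  have hg : ((1 : H) : H ⧸ ⨆ x, 𝒢.vert x) = g :=
    SerreGraph.Reachable.apply_eq toQuotient_t (hconn ⟨x, (1 : H)⟩ ⟨x, g⟩)
  simpa using QuotientGroup.eq.1 hg

section ToAmbient

variable (T : Set Λ.E)

theorem map_toAmbient_vertImage (x : Λ.V) :
    (𝒢.vertImage T x).map (𝒢.toAmbient T) = 𝒢.vert x := by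
  ext a
  simp [vertImage]

theorem map_toAmbient_edgeImage (e : Λ.E) :
    (𝒢.edgeImage T e).map (𝒢.toAmbient T) = 𝒢.edge e := by
  ext a
  simp [edgeImage]

/-- The morphism `g 𝒢_λ ↦ f(g) 𝒢_λ`, where `f` is the homomorphism to the ambient group. -/
def bassSerreToCosetGraph : SerreGraph.Hom (𝒢.bassSerreGraph T) 𝒢.cosetGraph where
  onV := Sigma.map id fun x =>
    cosetMap (𝒢.toAmbient T) (Subgroup.map_le_iff_le_comap.1 (𝒢.map_toAmbient_vertImage T x).le)
  onE := Sigma.map id fun e =>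
    cosetMap (𝒢.toAmbient T) (Subgroup.map_le_iff_le_comap.1 (𝒢.map_toAmbient_edgeImage T e).le)
  map_o := by
    rintro ⟨e, ⟨g⟩⟩
    exact (sigma_coset_eq_iff 𝒢.vert).2 ⟨rfl, by simp⟩
  map_inv := by
    rintro ⟨e, ⟨g⟩⟩
    exact (sigma_coset_eq_iff 𝒢.edge).2 ⟨rfl, by simp⟩

theorem isImmersion_bassSerreToCosetGraph : (𝒢.bassSerreToCosetGraph T).IsImmersion := by
  rintro ⟨e, ⟨g⟩⟩ ⟨f, ⟨g'⟩⟩ ht hef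
  obtain ⟨rfl, hmem⟩ : e = f ∧ (𝒢.toAmbient T g)⁻¹ * 𝒢.toAmbient T g' ∈ 𝒢.edge e :=
    (sigma_coset_eq_iff 𝒢.edge).1 hef
  obtain ⟨-, a, ha⟩ : _ ∧ g⁻¹ * g' ∈ 𝒢.vertImage T (Λ.t e) :=
    (sigma_coset_eq_iff (𝒢.vertImage T)).1 ht
  rw [← map_inv, ← map_mul, ← ha, toAmbient_ofVert] at hmem
  exact (sigma_coset_eq_iff (𝒢.edgeImage T)).2 ⟨rfl, ⟨a, hmem⟩, ha⟩

variable {T}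

theorem injective_toAmbient (hT : Λ.IsMaximalTree T) (h : 𝒢.cosetGraph.IsForest) :
    Function.Injective (𝒢.toAmbient T) := by
  refine (injective_iff_map_eq_one _).2 fun g hg => ?_
  obtain ⟨x⟩ : Nonempty Λ.V := hT.2.1.1
  have himage : (𝒢.bassSerreToCosetGraph T).onV ⟨x, (1 : 𝒢.Pi1 T)⟩ =
      (𝒢.bassSerreToCosetGraph T).onV ⟨x, g⟩ :=
    (sigma_coset_eq_iff 𝒢.vert).2 ⟨rfl, by simp [hg]⟩
  have hcoset := (𝒢.isImmersion_bassSerreToCosetGraph T).injective_onV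
    (𝒢.bassSerreGraph_isConnected hT) h himage
  obtain ⟨-, a, ha⟩ := (sigma_coset_eq_iff (𝒢.vertImage T)).1 hcoset
  rw [inv_one, one_mul] at ha
  rw [← ha, toAmbient_ofVert] at hg
  rw [← ha, OneMemClass.coe_eq_one.1 hg, map_one]

theorem bijective_onV_bassSerreToCosetGraph (h : Function.Bijective (𝒢.toAmbient T)) :
    Function.Bijective (𝒢.bassSerreToCosetGraph T).onV :=
  bijective_sigma_map_cosetMap h.2 fun x => by
    rw [← 𝒢.map_toAmbient_vertImage T, Subgroup.comap_map_eq_self_of_injective h.1]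

theorem bijective_onE_bassSerreToCosetGraph (h : Function.Bijective (𝒢.toAmbient T)) :
    Function.Bijective (𝒢.bassSerreToCosetGraph T).onE :=
  bijective_sigma_map_cosetMap h.2 fun e => by
    rw [← 𝒢.map_toAmbient_edgeImage T, Subgroup.comap_map_eq_self_of_injective h.1]

/-- The isomorphism `g 𝒢_λ ↦ f(g) 𝒢_λ` induced by an isomorphism `f` from the fundamental group
to the ambient group. -/
noncomputable def bassSerreIso (h : Function.Bijective (𝒢.toAmbient T)) :
    SerreGraph.Iso (𝒢.bassSerreGraph T) 𝒢.cosetGraph :=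
  (𝒢.bassSerreToCosetGraph T).toIso (𝒢.bijective_onV_bassSerreToCosetGraph h)
    (𝒢.bijective_onE_bassSerreToCosetGraph h)

theorem bijective_toAmbient_iff (hT : Λ.IsMaximalTree T) :
    Function.Bijective (𝒢.toAmbient T) ↔ 𝒢.cosetGraph.IsTree := by
  refine ⟨fun h => (𝒢.bassSerreIso h).isTree (bassSerreGraph_isTree hT), fun h => ?_⟩
  refine ⟨𝒢.injective_toAmbient hT h.2, MonoidHom.range_eq_top.1 ?_⟩
  rw [range_toAmbient, 𝒢.iSup_vert_eq_top h.1]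

end ToAmbient

/-! ### The topology of the fundamental group -/

section Topology

variable {𝒢} {T : Set Λ.E} [TopologicalSpace H]

theorem isOpen_image_ofVert (g : 𝒢.Pi1 T) (x : Λ.V) (U : OpenSubgroup (𝒢.vert x)) :
    IsOpen ((fun a => g * 𝒢.ofVert T x a) '' U) :=
  TopologicalSpace.isOpen_generateFrom_of_mem ⟨g, x, U, rfl⟩

variable [NonarchimedeanGroup H]

theorem exists_openSubgroup_vert (x : Λ.V) {O : Set H} (hO : O ∈ 𝓝 (1 : H)) :
    ∃ U : OpenSubgroup (𝒢.vert x), ∀ a ∈ U, (a : H) ∈ O := by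
  obtain ⟨V, hV⟩ := NonarchimedeanGroup.is_nonarchimedean O hO
  exact ⟨V.comap (𝒢.vert x).subtype continuous_subtype_val, fun a ha => hV ha⟩

variable [Nonempty Λ.V]

theorem continuous_toAmbient : Continuous (𝒢.toAmbient T) := by
  refine ⟨fun O hO => isOpen_iff_forall_mem_open.2 fun g hg => ?_⟩
  obtain ⟨x⟩ := ‹Nonempty Λ.V›
  obtain ⟨U, hU⟩ := exists_openSubgroup_vert (𝒢 := 𝒢) x
    ((hO.preimage (continuous_const_mul (𝒢.toAmbient T g))).mem_nhds (by simpa using hg))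
  refine ⟨_, ?_, isOpen_image_ofVert g x U, 1, one_mem U, by simp⟩
  rintro _ ⟨a, ha, rfl⟩
  simpa using hU a ha

theorem isInducing_toAmbient (hopen : ∀ x, IsOpen (𝒢.vert x : Set H))
    (hinj : Function.Injective (𝒢.toAmbient T)) : Topology.IsInducing (𝒢.toAmbient T) := by
  refine ⟨le_antisymm (continuous_iff_le_induced.1 continuous_toAmbient) (le_generateFrom ?_)⟩
  rintro _ ⟨g, x, U, rfl⟩
  refine isOpen_induced_iff.2 ⟨(fun h => 𝒢.toAmbient T g * h) '' (Subtype.val '' (U : Set _)),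
    isOpenMap_mul_left _ _ ((hopen x).isOpenMap_subtype_val _ U.isOpen), ?_⟩
  rw [← hinj.preimage_image ((fun a => g * 𝒢.ofVert T x a) '' (U : Set (𝒢.vert x)))]
  simp only [Set.image_image, map_mul, toAmbient_ofVert]
  rfl

theorem hasBasis_nhds_one (h : Topology.IsInducing (𝒢.toAmbient T)) :
    (𝓝 (1 : 𝒢.Pi1 T)).HasBasis (fun _ : Σ x : Λ.V, OpenSubgroup (𝒢.vert x) => True)
      (fun p => 𝒢.ofVert T p.1 '' p.2) := by
  refine Filter.hasBasis_iff.2 fun A => ⟨fun hA => ?_, ?_⟩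
  · rw [h.nhds_eq_comap, map_one] at hA
    obtain ⟨O, hO, hOA⟩ := hA
    obtain ⟨x⟩ := ‹Nonempty Λ.V›
    obtain ⟨U, hU⟩ := exists_openSubgroup_vert (𝒢 := 𝒢) x hO
    refine ⟨⟨x, U⟩, trivial, Set.image_subset_iff.2 fun a ha => hOA ?_⟩
    simpa using hU a ha
  · rintro ⟨⟨x, U⟩, -, hUA⟩
    have hU : IsOpen (𝒢.ofVert T x '' U) := by
      simpa using isOpen_image_ofVert (1 : 𝒢.Pi1 T) x U
    exact Filter.mem_of_superset (hU.mem_nhds ⟨1, one_mem U, map_one _⟩) hUA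

/-- The isomorphism of topological groups given by a bijective homomorphism that induces the
topology of the fundamental group. -/
noncomputable def continuousMulEquivAmbient (h : Function.Bijective (𝒢.toAmbient T))
    (hind : Topology.IsInducing (𝒢.toAmbient T)) : 𝒢.Pi1 T ≃ₜ* H :=
  .mk' ((Equiv.ofBijective _ h).toHomeomorphOfIsInducing hind) (map_mul (𝒢.toAmbient T))

end Topology

end GraphOfSubgroups

/-! ### Van Dantzig's theorem -/

open scoped Pointwise in
theorem exists_openSubgroup_subset_of_isCompact_of_isOpen {G : Type*} [Group G]
    [TopologicalSpace G] [IsTopologicalGroup G] {V : Set G} (hVc : IsCompact V) (hVo : IsOpen V)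
    (hV : (1 : G) ∈ V) : ∃ U : OpenSubgroup G, (U : Set G) ⊆ V := by
  obtain ⟨N, hN, hNV⟩ := compact_open_separated_mul_left hVc hVo subset_rfl
  have hstab : (MulAction.stabilizer G V : Set G) ∈ 𝓝 1 := by
    filter_upwards [hN, inv_mem_nhds_one G hN] with g hg hg'
    refine subset_antisymm ((Set.smul_set_subset_smul hg).trans hNV) ?_
    exact Set.subset_smul_set_iff.2 ((Set.smul_set_subset_smul (Set.mem_inv.1 hg')).trans hNV)
  refine ⟨⟨MulAction.stabilizer G V, Subgroup.isOpen_of_mem_nhds _ hstab⟩, fun g hg => ?_⟩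
  rw [← (hg : g • V = V)]
  simpa using Set.smul_mem_smul_set (a := g) hV

theorem nonarchimedeanGroup_of_totallyDisconnected_locallyCompact (G : Type*) [Group G]
    [TopologicalSpace G] [IsTopologicalGroup G] [TotallyDisconnectedSpace G]
    [LocallyCompactSpace G] : NonarchimedeanGroup G where
  is_nonarchimedean O hO := by
    obtain ⟨K, hK, h1K, hKO⟩ := exists_compact_subset isOpen_interior
      (mem_interior_iff_mem_nhds.2 hO)
    obtain ⟨V, hV, h1V, hVK⟩ := loc_compact_Haus_tot_disc_of_zero_dim.mem_nhds_iff.1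
      (isOpen_interior.mem_nhds h1K)
    have hVc : IsCompact V := hK.of_isClosed_subset hV.1 (hVK.trans interior_subset)
    obtain ⟨U, hU⟩ := exists_openSubgroup_subset_of_isCompact_of_isOpen hVc hV.2 h1V
    exact ⟨U, hU.trans <| hVK.trans <| interior_subset.trans <| hKO.trans interior_subset⟩

/-! ### The residue graph -/

namespace Building

variable {B : Type*} {M : CoxeterMatrix B} {W : Type*} [Group W] {cs : CoxeterSystem M W}
  {C : Type*} (Δ : Building cs C)

theorem res_eq_res_iff {J : Set B} {c d : C} : Δ.res J c = Δ.res J d ↔ d ∈ Δ.res J c :=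
  ⟨fun h => h ▸ Δ.mem_res_self J d, Δ.res_eq_of_mem⟩

theorem rel_of_mem_res {J : Set B} {r : C → C → Prop} (hr : Equivalence r)
    (hadj : ∀ s ∈ J, ∀ c d, Δ.δ c d = cs.simple s → r c d) {c d : C} (h : d ∈ Δ.res J c) :
    r c d := by
  have hstep : ∀ s ∈ J, ∀ w, (∀ c, Δ.δ c d = w → r c d) →
      ∀ c, Δ.δ c d = cs.simple s * w → r c d := by
    intro s hs w ih c hc
    obtain ⟨c', hc', hd⟩ := Δ.exists_adj c d s
    exact hr.trans (hr.symm (hadj s hs c' c hc')) (ih c' (by simp [hd, hc]))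
  suffices ∀ w ∈ cs.special J, ∀ c, Δ.δ c d = w → r c d from this _ h c rfl
  intro w hw
  induction hw using Subgroup.closure_induction_left with
  | one => exact fun c hc => (Δ.δ_eq_one c d).1 hc ▸ hr.refl c
  | mul_left x hx w _ ih =>
    obtain ⟨s, hs, rfl⟩ := hx
    exact hstep s hs w ih
  | inv_mul_cancel x hx w _ ih =>
    obtain ⟨s, hs, rfl⟩ := hx
    rw [cs.inv_simple]
    exact hstep s hs w ih

theorem mk_inv_δ_eq_of_mem_res {J : Set B} {c d : C} (b : C) (h : d ∈ Δ.res J c) :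
    (((Δ.δ c b)⁻¹ : W) : W ⧸ cs.special J) = ((Δ.δ d b)⁻¹ : W) := by
  refine Δ.rel_of_mem_res
    (r := fun c d => (((Δ.δ c b)⁻¹ : W) : W ⧸ cs.special J) = ((Δ.δ d b)⁻¹ : W))
    ⟨fun _ => rfl, Eq.symm, Eq.trans⟩ (fun s hs c d hcd => ?_) h
  have hs : cs.simple s ∈ cs.special J := Subgroup.subset_closure ⟨s, hs, rfl⟩
  rcases Δ.δ_adj d b c s hcd with hδ | hδ
  · rw [hδ, mul_inv_rev, QuotientGroup.mk_mul_of_mem _ (inv_mem hs)]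
  · rw [hδ]

/-- Folding the residues of type `J` onto the cosets of `W_J` as seen from the chamber `b`: the
residue of `d` goes to the coset of `δ(b, d) = δ(d, b)⁻¹`. -/
noncomputable def foldResidue (b : C) (J : Set B) (R : Δ.residues J) : W ⧸ cs.special J :=
  ((Δ.δ R.2.choose b)⁻¹ : W)

theorem foldResidue_res (b : C) (J : Set B) (d : C) :
    Δ.foldResidue b J ⟨Δ.res J d, Set.mem_range_self d⟩ = ((Δ.δ d b)⁻¹ : W) :=
  Δ.mk_inv_δ_eq_of_mem_res b <| Δ.res_eq_res_iff.1
    (Set.mem_range_self (f := Δ.res J) d).choose_spec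

theorem res_eq_of_foldResidue_eq {J : Set B} {b d : C}
    (h : Δ.foldResidue b J ⟨Δ.res J d, Set.mem_range_self d⟩ =
      Δ.foldResidue b J ⟨Δ.res J b, Set.mem_range_self b⟩) : Δ.res J d = Δ.res J b := by
  rw [foldResidue_res, foldResidue_res, (Δ.δ_eq_one b b).2 rfl, QuotientGroup.eq] at h
  exact Δ.res_eq_of_mem (by simpa [res] using h)

variable {Λ : SerreGraph.{u, v}} (D : SpecialData Λ B)

theorem residueGraph_o (e : Λ.E) (c : C) :
    (Δ.residueGraph D).o ⟨e, Δ.res (D.edge e) c, Set.mem_range_self c⟩ =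
      ⟨Λ.o e, Δ.res (D.vert (Λ.o e)) c, Set.mem_range_self c⟩ :=
  Δ.sigma_residue_eq D.vert rfl (Δ.resMap_res _ c)

theorem residueGraph_inv (e : Λ.E) (c : C) :
    (Δ.residueGraph D).inv ⟨e, Δ.res (D.edge e) c, Set.mem_range_self c⟩ =
      ⟨Λ.inv e, Δ.res (D.edge (Λ.inv e)) c, Set.mem_range_self c⟩ :=
  Δ.sigma_residue_eq D.edge rfl (by simp only [D.edge_inv])

/-- The morphism from the residue graph to the coset graph of the special subgroups that folds
all residues as seen from `b`. -/
noncomputable def foldResidueGraph (b : C) :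
    SerreGraph.Hom (Δ.residueGraph D) (D.graphOfSpecial cs).cosetGraph where
  onV p := ⟨p.1, Δ.foldResidue b (D.vert p.1) p.2⟩
  onE p := ⟨p.1, Δ.foldResidue b (D.edge p.1) p.2⟩
  map_o := by
    rintro ⟨e, _, d, rfl⟩
    rw [residueGraph_o, foldResidue_res, foldResidue_res]
    rfl
  map_inv := by
    rintro ⟨e, _, d, rfl⟩
    rw [residueGraph_inv, foldResidue_res, foldResidue_res]
    rfl

theorem residueGraph_isForest (h : (D.graphOfSpecial cs).cosetGraph.IsTree) :
    (Δ.residueGraph D).IsForest := by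
  refine SerreGraph.Hom.isForest_of_exists_fiber_eq h ?_
  rintro ⟨e, _, b, rfl⟩
  refine ⟨Δ.foldResidueGraph D b, ?_⟩
  rintro ⟨f, _, d, rfl⟩ hf
  obtain rfl : f = e := congrArg Sigma.fst hf
  exact Δ.sigma_residue_eq D.edge rfl
    (Δ.res_eq_of_foldResidue_eq (eq_of_heq (Sigma.mk.inj_iff.1 hf).2))

/-- The copy of `Λ` in the residue graph formed by the residues of the chamber `c`. -/
def toResidueGraph (c : C) : SerreGraph.Hom Λ (Δ.residueGraph D) where
  onV x := ⟨x, Δ.res (D.vert x) c, Set.mem_range_self c⟩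
  onE e := ⟨e, Δ.res (D.edge e) c, Set.mem_range_self c⟩
  map_o e := (Δ.residueGraph_o D e c).symm
  map_inv e := (Δ.residueGraph_inv D e c).symm

theorem residueGraph_isConnected (hΛ : Λ.IsConnected) (hgen : ⨆ x, cs.special (D.vert x) = ⊤) :
    (Δ.residueGraph D).IsConnected := by
  have htop : cs.special (⋃ x, D.vert x) = ⊤ := by
    rw [← hgen, CoxeterSystem.special, Set.image_iUnion, Subgroup.closure_iUnion]
    rfl
  have hsheet (c : C) (x y : Λ.V) : (Δ.residueGraph D).Reachable
      ((Δ.toResidueGraph D c).onV x) ((Δ.toResidueGraph D c).onV y) :=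
    (Δ.toResidueGraph D c).reachable_map (hΛ.2 x y)
  have hchamber (x : Λ.V) (c d : C) : (Δ.residueGraph D).Reachable
      ((Δ.toResidueGraph D c).onV x) ((Δ.toResidueGraph D d).onV x) := by
    refine Δ.rel_of_mem_res (J := ⋃ x, D.vert x)
      (r := fun c d => (Δ.residueGraph D).Reachable
        ((Δ.toResidueGraph D c).onV x) ((Δ.toResidueGraph D d).onV x))
      ⟨fun _ => .refl _, .symm, .trans⟩ (fun s hs c d hcd => ?_) (by simp [res, htop])
    obtain ⟨y, hy⟩ := Set.mem_iUnion.1 hs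
    have hd : d ∈ Δ.res (D.vert y) c := by
      rw [res, Set.mem_ofPred_eq, hcd]
      exact Subgroup.subset_closure ⟨s, hy, rfl⟩
    have hcd : (Δ.toResidueGraph D c).onV y = (Δ.toResidueGraph D d).onV y :=
      Δ.sigma_residue_eq D.vert rfl (Δ.res_eq_of_mem hd)
    exact (hsheet c x y).trans (hcd ▸ hsheet d y x)
  refine ⟨hΛ.1.map (Δ.toResidueGraph D Δ.nonempty.some).onV, ?_⟩
  rintro ⟨x, _, c, rfl⟩ ⟨y, _, d, rfl⟩
  exact (hsheet c x y).trans (hchamber y c d)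

theorem residueGraph_isTree (hΛ : Λ.IsConnected)
    (h : (D.graphOfSpecial cs).cosetGraph.IsTree) : (Δ.residueGraph D).IsTree :=
  ⟨Δ.residueGraph_isConnected D hΛ ((D.graphOfSpecial cs).iSup_vert_eq_top h.1),
    Δ.residueGraph_isForest D h⟩

/-! ### Chamber-transitive actions -/

section Action

variable {G : Type*} [Group G] (φ : G →* Δ.aut₀)

theorem mem_setStabiliser_res {J : Set B} {c : C} {g : G} :
    g ∈ Δ.setStabiliser φ (Δ.res J c) ↔ Δ.res J ((φ g).1 c) = Δ.res J c := by
  rw [← Δ.image_res φ]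
  rfl

theorem res_apply_eq_iff {J : Set B} {c : C} {g g' : G} :
    Δ.res J ((φ g).1 c) = Δ.res J ((φ g').1 c) ↔ g⁻¹ * g' ∈ Δ.setStabiliser φ (Δ.res J c) := by
  have h : (φ g').1 c = (φ g).1 ((φ (g⁻¹ * g')).1 c) := by
    rw [← Equiv.Perm.mul_apply, ← Subgroup.coe_mul, ← map_mul, mul_inv_cancel_left]
  rw [mem_setStabiliser_res, h, ← Δ.image_res φ, ← Δ.image_res φ g,
    (φ g).1.injective.image_injective.eq_iff]
  exact eq_comm

/-- The orbit map `g ↦ Res_J(g c)` on the cosets of the stabiliser of `Res_J(c)`. -/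
def cosetToResidue (J : Set B) (c : C) : G ⧸ Δ.setStabiliser φ (Δ.res J c) → Δ.residues J :=
  Quotient.lift (fun g => ⟨Δ.res J ((φ g).1 c), Set.mem_range_self _⟩) fun _ _ h =>
    Subtype.ext <| (Δ.res_apply_eq_iff φ).2 <| QuotientGroup.leftRel_apply.1 h

variable {φ}

theorem bijective_cosetToResidue (htrans : ∀ c d : C, ∃ g : G, (φ g).1 c = d) (J : Set B) (c : C) :
    Function.Bijective (Δ.cosetToResidue φ J c) := by
  constructor
  · rintro ⟨g⟩ ⟨g'⟩ h
    exact QuotientGroup.eq.2 ((Δ.res_apply_eq_iff φ).1 (congrArg Subtype.val h))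
  · rintro ⟨_, d, rfl⟩
    obtain ⟨g, rfl⟩ := htrans c d
    exact ⟨g, rfl⟩

/-- For a chamber-transitive action, the orbit maps identify the coset graph of the stabilisers
of the residues of `c` with the residue graph. -/
noncomputable def cosetResidueIso (htrans : ∀ c d : C, ∃ g : G, (φ g).1 c = d) (c : C) :
    SerreGraph.Iso (Δ.stabiliserGraph φ D c).cosetGraph (Δ.residueGraph D) :=
  SerreGraph.Hom.toIso
    { onV := Sigma.map id fun x => Δ.cosetToResidue φ (D.vert x) c
      onE := Sigma.map id fun e => Δ.cosetToResidue φ (D.edge e) c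
      map_o := by
        rintro ⟨e, ⟨g⟩⟩
        exact (Δ.residueGraph_o D e _).symm
      map_inv := by
        rintro ⟨e, ⟨g⟩⟩
        exact (Δ.residueGraph_inv D e _).symm }
    (Equiv.sigmaCongrRight fun x =>
      .ofBijective _ (Δ.bijective_cosetToResidue htrans (D.vert x) c)).bijective
    (Equiv.sigmaCongrRight fun e =>
      .ofBijective _ (Δ.bijective_cosetToResidue htrans (D.edge e) c)).bijective

end Action

section Topology

variable {G : Type*} [Group G] [TopologicalSpace G] {φ : G →* Δ.aut₀}

theorem isOpen_setStabiliser_res [SeparatelyContinuousMul G] (hφ : Continuous φ) (J : Set B)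
    (c : C) : IsOpen (Δ.setStabiliser φ (Δ.res J c) : Set G) := by
  have hfix : IsOpen {h : Δ.aut₀ | ∀ d ∈ ({c} : Finset C), h.1 d = (1 : Δ.aut₀).1 d} :=
    TopologicalSpace.isOpen_generateFrom_of_mem ⟨1, {c}, rfl⟩
  refine Subgroup.isOpen_of_mem_nhds _
    (Filter.mem_of_superset ((hfix.preimage hφ).mem_nhds (x := 1) (by simp)) fun g hg => ?_)
  have hgc : (φ g).1 c = c := by simpa using hg
  exact (Δ.mem_setStabiliser_res φ).2 (by rw [hgc])

theorem stabiliserGraph_isTDLC [IsTopologicalGroup G] [TotallyDisconnectedSpace G]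
    [LocallyCompactSpace G] (hφ : Continuous φ) (c : C) : (Δ.stabiliserGraph φ D c).IsTDLC := by
  have hopen (J) := Δ.isOpen_setStabiliser_res hφ J c
  refine ⟨fun x => ⟨inferInstance, (hopen (D.vert x)).locallyCompactSpace⟩,
    fun e => ⟨inferInstance, (hopen (D.edge e)).locallyCompactSpace⟩, fun e => ?_⟩
  have hle := (Δ.stabiliserGraph φ D c).edge_le e
  exact ⟨continuous_inclusion hle, (Topology.IsOpenEmbedding.inclusion hle
    ((hopen (D.edge e)).preimage continuous_subtype_val)).isOpenMap⟩

end Topology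

end Building

theorem corollaryG_general {B : Type*} {M : CoxeterMatrix B} {W : Type*} [Group W]
    (cs : CoxeterSystem M W) {C : Type*} (Δ : Building cs C)
    {Λ : SerreGraph} (D : SpecialData Λ B) (hD : D.IsVisualDecomposition cs)
    {G : Type*} [Group G] [TopologicalSpace G] [IsTopologicalGroup G]
    [TotallyDisconnectedSpace G] [LocallyCompactSpace G]
    (φ : G →* Δ.aut₀) (hφ : Continuous φ) (htrans : ∀ c d : C, ∃ g : G, (φ g).1 c = d)
    (c : C) :
    Λ.IsTree ∧ (Δ.stabiliserGraph φ D c).IsTDLC ∧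
    ∀ T : Set Λ.E, Λ.IsMaximalTree T →
      IsTopologicalGroup ((Δ.stabiliserGraph φ D c).Pi1 T) ∧
      (𝓝 (1 : (Δ.stabiliserGraph φ D c).Pi1 T)).HasBasis
        (fun _ : Σ x : Λ.V, OpenSubgroup ((Δ.stabiliserGraph φ D c).vert x) => True)
        (fun p => (Δ.stabiliserGraph φ D c).ofVert T p.1 '' p.2) ∧
      (∃ f : (Δ.stabiliserGraph φ D c).Pi1 T ≃ₜ* G,
        ∀ g, f g = (Δ.stabiliserGraph φ D c).toAmbient T g) ∧
      ((Δ.stabiliserGraph φ D c).bassSerreGraph T).IsTree ∧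
      ∃ Φ : SerreGraph.Iso ((Δ.stabiliserGraph φ D c).bassSerreGraph T) (Δ.residueGraph D),
        (∀ (x : Λ.V) (g : (Δ.stabiliserGraph φ D c).Pi1 T),
          Φ.onV ⟨x, QuotientGroup.mk g⟩ = ⟨x, Δ.res (D.vert x)
            ((φ ((Δ.stabiliserGraph φ D c).toAmbient T g)).1 c), Set.mem_range_self _⟩) ∧
        ∀ (e : Λ.E) (g : (Δ.stabiliserGraph φ D c).Pi1 T),
          Φ.onE ⟨e, QuotientGroup.mk g⟩ = ⟨e, Δ.res (D.edge e)
            ((φ ((Δ.stabiliserGraph φ D c).toAmbient T g)).1 c), Set.mem_range_self _⟩ := by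
  obtain ⟨hΛ, T₀, hT₀, hbij₀⟩ := hD
  have : Nonempty Λ.V := hΛ.1
  have : NonarchimedeanGroup G := nonarchimedeanGroup_of_totallyDisconnected_locallyCompact G
  have hspecial : (D.graphOfSpecial cs).cosetGraph.IsTree :=
    ((D.graphOfSpecial cs).bijective_toAmbient_iff hT₀).1 hbij₀
  have hcoset : (Δ.stabiliserGraph φ D c).cosetGraph.IsTree :=
    (Δ.cosetResidueIso D htrans c).symm.isTree (Δ.residueGraph_isTree D hΛ hspecial)
  refine ⟨⟨hΛ, GraphOfSubgroups.isForest_of_isForest_cosetGraph _ hspecial.2⟩,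
    Δ.stabiliserGraph_isTDLC D hφ c, fun T hT => ?_⟩
  have hbij := ((Δ.stabiliserGraph φ D c).bijective_toAmbient_iff hT).2 hcoset
  have hind := GraphOfSubgroups.isInducing_toAmbient
    (fun x => Δ.isOpen_setStabiliser_res hφ (D.vert x) c) hbij.1
  exact ⟨hind.topologicalGroup _, GraphOfSubgroups.hasBasis_nhds_one hind,
    ⟨GraphOfSubgroups.continuousMulEquivAmbient hbij hind, fun _ => rfl⟩,
    GraphOfSubgroups.bassSerreGraph_isTree hT,
    (GraphOfSubgroups.bassSerreIso _ hbij).trans (Δ.cosetResidueIso D htrans c),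
    fun _ _ => rfl, fun _ _ => rfl⟩

theorem corollaryG {B : Type*} [Finite B] {M : CoxeterMatrix B} {W : Type*} [Group W]
    (cs : CoxeterSystem M W) {C : Type*} (Δ : Building cs C)
    {Λ : SerreGraph} (D : SpecialData Λ B) (hD : D.IsVisualDecomposition cs)
    {G : Type*} [Group G] [TopologicalSpace G] [IsTopologicalGroup G]
    [TotallyDisconnectedSpace G] [LocallyCompactSpace G] [SigmaCompactSpace G]
    (φ : G →* Δ.aut₀) (hφ : Continuous φ) (htrans : ∀ c d : C, ∃ g : G, (φ g).1 c = d)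
    (c : C) :
    Λ.IsTree ∧ (Δ.stabiliserGraph φ D c).IsTDLC ∧
    ∀ T : Set Λ.E, Λ.IsMaximalTree T →
      -- the fundamental group is a topological group, and the open subgroups of the vertex
      -- groups form a basis of neighbourhoods of the identity
      IsTopologicalGroup ((Δ.stabiliserGraph φ D c).Pi1 T) ∧
      (𝓝 (1 : (Δ.stabiliserGraph φ D c).Pi1 T)).HasBasis
        (fun _ : Σ x : Λ.V, OpenSubgroup ((Δ.stabiliserGraph φ D c).vert x) => True)
        (fun p => (Δ.stabiliserGraph φ D c).ofVert T p.1 '' p.2) ∧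
      -- the homomorphism to `G` induced by the inclusions is a topological isomorphism
      (∃ f : (Δ.stabiliserGraph φ D c).Pi1 T ≃ₜ* G,
        ∀ g, f g = (Δ.stabiliserGraph φ D c).toAmbient T g) ∧
      -- the Bass–Serre graph is a tree, isomorphic to the residue graph through
      -- `g 𝒢_λ ↦ Res_{S_λ}(g c)`
      ((Δ.stabiliserGraph φ D c).bassSerreGraph T).IsTree ∧
      ∃ Φ : SerreGraph.Iso ((Δ.stabiliserGraph φ D c).bassSerreGraph T) (Δ.residueGraph D),
        (∀ (x : Λ.V) (g : (Δ.stabiliserGraph φ D c).Pi1 T),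
          Φ.onV ⟨x, QuotientGroup.mk g⟩ = ⟨x, Δ.res (D.vert x)
            ((φ ((Δ.stabiliserGraph φ D c).toAmbient T g)).1 c), Set.mem_range_self _⟩) ∧
        ∀ (e : Λ.E) (g : (Δ.stabiliserGraph φ D c).Pi1 T),
          Φ.onE ⟨e, QuotientGroup.mk g⟩ = ⟨e, Δ.res (D.edge e)
            ((φ ((Δ.stabiliserGraph φ D c).toAmbient T g)).1 c), Set.mem_range_self _⟩ :=
  corollaryG_general cs Δ D hD φ hφ htrans c
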